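/- Let $G$ be a Lie group with Lie algebra $\mathfrak g$, let $(M,\omega)$ be a symplectic manifold with a Hamiltonian $G$-action and a $G$-equivariant moment map $\mu\colon M\to\mathfrak g^*$, so that $\iota_{X^\sharp}\omega=d\langle\mu,X\rangle$ for $X\in\mathfrak g$, where $X^\sharp(m)=\frac{d}{dt}\big|_{t=0}\exp(tX)m$, and $\mu(gm)(X)=\mu(m)(\mathrm{Ad}_{g^{-1}}X)$. Let $\mathcal Z$ be the derived zero set of $\mu$, that is, the dg-manifold with underlying manifold $M$, functions $C^\infty(M)\otimes\bigwedge^{-\bullet}\mathfrak g$ ($\mathfrak g$ in degree $-1$) and differential $\iota_\mu$, where $\iota_\mu(X)=\langle\mu,X\rangle$ for $X\in\mathfrak g$. Let $\mathcal Z/G=\{G\times\mathcal Z\rightrightarrows\mathcal Z\}$ be the action groupoid, with source $s$ the projection, target $t$ the action (on functions, $t^*X=\mathrm{Ad}_{g^{-1}}X$ at $(g,m)$ for $X\in\mathfrak g$), and nerve $G^r\times\mathcal Z$ in simplicial degree $r$. The forms $\Omega^p_{C^\infty(G^r\times\mathcal Z),q}$ of form degree $p$ and derived degree $q$ on $G^r\times\mathcal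 Z$ are the elements of bidegree $(p,q)$ of the bigraded-commutative algebra generated over $\Omega^\bullet(G^r\times M)$ (in bidegrees $(l,0)$) by $E$ and $dE$, for $E\in\mathfrak g$, of bidegrees $(0,-1)$ and $(1,-1)$; the sign rule is $ab=(-1)^{pp'+qq'}ba$. On them act the commuting differentials $d$ (de Rham, $E\mapsto dE$) and $\iota_\mu$ (the derivation of bidegree $(0,1)$ which vanishes on $\Omega^\bullet(G^r\times M)$ and satisfies $\iota_\mu E=\langle\mu,E\rangle$, $\iota_\mu dE=d\langle\mu,E\rangle$), and the simplicial differential $\partial^*=\sum_k(-1)^k\partial_k^*$, the alternating sum of the pullbacks along the face maps, with $\partial^*=s^*-t^*$ in simplicial degree $0$. Put $$\mathrm{DR}^m(\mathcal Z/G)=\prod_{p+r+q=m}\Omega^p_{C^\infty(G^r\times\mathcal Z),q},\qquad D_\varepsilon=d+(-1)^p\iota_\mu+\varepsilon(-1)^{p+q}\partial^*\quad(\varepsilon=\pm1);$$ the operators $D_{+}$ and $D_{-}$ are conjugate under multiplication by $(-1)^r$ in simplicial degree $r$. Let $\iota_{\mathcal Z}^*\omega\in\Omega^2_{C^\infty(\mathcal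 Z),0}$ be the pullback of $\omega$ along $\iota_{\mathcal Z}\colon\mathcal Z\to M$, let $\theta=\sum_iE_i\,\theta_i\in\Omega^1_{C^\infty(G\times\mathcal Z),-1}$ be the left Maurer–Cartan form on $G$, written in a basis $\{E_i\}$ of $\mathfrak g$ and pulled back to $G\times\mathcal Z$, and let $d\theta=\sum_i(E_i\,d\theta_i+dE_i\,\theta_i)\in\Omega^2_{C^\infty(G\times\mathcal Z),-1}$. Then: 1. $(s^*-t^*)\,\iota_{\mathcal Z}^*\omega=\iota_\mu\,d\theta$. 2. $\partial^*d\theta=0$. 3. The reduced form $\omega_{red}=\iota_{\mathcal Z}^*\omega+d\theta$ lies in $\mathrm{DR}^2(\mathcal Z/G)$ and is closed for the total differential $D_-=d+(-1)^p\iota_\mu-(-1)^{p+q}\partial^*$, that is, $D_-\,\omega_{red}=0$. Equivalently, $D_+(\iota_{\mathcal Z}^*\omega-d\theta)=0$. -/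

import Mathlib

open scoped Manifold ContDiff

noncomputable section

namespace BottShulman

universe u v

/-! ### Differential forms on a manifold

A differential `l`-form on `N` assigns to each point an alternating `l`-linear form on the tangent
space there; `TangentSpace I x` is by definition the model vector space `E`. -/

section Forms

variable {E : Type*} [NormedAddCommGroup E] [NormedSpace ℝ E]
  {H : Type*} [TopologicalSpace H] (I : ModelWithCorners ℝ E H)
  {N : Type*} [TopologicalSpace N] [ChartedSpace H N]
  {E' : Type*} [NormedAddCommGroup E'] [NormedSpace ℝ E']
  {H' : Type*} [TopologicalSpace H'] (I' : ModelWithCorners ℝ E' H')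
  {N' : Type*} [TopologicalSpace N'] [ChartedSpace H' N']

/-- The derivative of a map between manifolds, as a map of model vector spaces. -/
def tangentMapAt (f : N' → N) (x : N') : E' →L[ℝ] E := mfderiv I' I f x

/-- The differential of a real function, as a covector on the model vector space. -/
def differential (f : N → ℝ) (x : N) : E →L[ℝ] ℝ := mfderiv I 𝓘(ℝ, ℝ) f x

/-- The representative of a form in the preferred chart at `x₀`: the pullback of the form along
the inverse of the chart. -/
def chartRep {l : ℕ} (η : N → E [⋀^Fin l]→L[ℝ] ℝ) (x₀ : N) (y : E) : E [⋀^Fin l]→L[ℝ] ℝ :=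
  (η ((extChartAt I x₀).symm y)).compContinuousLinearMap
    (tangentMapAt I 𝓘(ℝ, E) (extChartAt I x₀).symm y)

/-- A form is smooth if its representatives in all the preferred charts are smooth. -/
def IsSmoothForm {l : ℕ} (η : N → E [⋀^Fin l]→L[ℝ] ℝ) : Prop :=
  ∀ x₀ : N, ContDiffOn ℝ ∞ (chartRep I η x₀) (extChartAt I x₀).target

/-- The exterior derivative of a form on a manifold, computed at `x` in the preferred chart
at `x`. -/
def extD {l : ℕ} (η : N → E [⋀^Fin l]→L[ℝ] ℝ) (x : N) : E [⋀^Fin (l + 1)]→L[ℝ] ℝ :=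
  (extDeriv (chartRep I η x) (extChartAt I x x)).compContinuousLinearMap
    (tangentMapAt 𝓘(ℝ, E) I (extChartAt I x) x)

/-- The pullback of a form along a map. -/
def pullForm {l : ℕ} (f : N' → N) (η : N → E [⋀^Fin l]→L[ℝ] ℝ) (x : N') :
    E' [⋀^Fin l]→L[ℝ] ℝ :=
  (η (f x)).compContinuousLinearMap (tangentMapAt I I' f x)

end Forms

/-! ### The fibre algebra

For a vector space `V` and an index set `ι`, let `Fib ι V` be (the product over all degrees of the homogeneous parts
of) the free bigraded commutative algebra over the exterior algebra of `V*` on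
generators `E_i` and `dE_i`, `i : ι`.
The bidegree (form degree, derived degree) of a covector is `(1, 0)`, that of `E_i` is `(0, -1)`,
that of `dE_i` is `(1, -1)`, and elements of bidegree `(p, q)` and `(p', q')` commute up to the
sign `(-1) ^ (p p' + q q')`. So covectors anticommute among themselves and with the `dE_i`,
the `E_i` anticommute among themselves and with the `dE_i`, the `E_i` commute with covectors, and
the `dE_i` commute among themselves.
The family `F : Fib ι V` stands for the sum `∑ E_J * dE_K * F J K l` over all `J`, `K`, `l`, where
`E_J` is the product of the `E_i`, `i ∈ J`, in increasing order, and `dE_K = ∏ dE_i ^ K i`. -/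

section Fibre

variable {ι : Type*} [Fintype ι] [LinearOrder ι]
  {V : Type*} [NormedAddCommGroup V] [NormedSpace ℝ V]
  {V' : Type*} [NormedAddCommGroup V'] [NormedSpace ℝ V']

variable (ι V) in
/-- Families of components of an element of the fibre algebra. -/
abbrev Fib : Type _ := Finset ι → (ι → ℕ) → ∀ l : ℕ, V [⋀^Fin l]→L[ℝ] ℝ

/-- The exterior product of a covector with an alternating form. -/
def wedge (α : V →L[ℝ] ℝ) {l : ℕ} (η : V [⋀^Fin l]→L[ℝ] ℝ) : V [⋀^Fin (l + 1)]→L[ℝ] ℝ :=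
  ContinuousAlternatingMap.alternatizeUncurryFin (α.smulRight η)

/-- Left multiplication by `E_i`. -/
def mulE (i : ι) (F : Fib ι V) : Fib ι V := fun J K l =>
  if i ∈ J then (-1 : ℝ) ^ (J.filter (· < i)).card • F (J.erase i) K l else 0

/-- Left multiplication by `dE_i`. -/
def mulDE (i : ι) (F : Fib ι V) : Fib ι V := fun J K l =>
  if 0 < K i then (-1 : ℝ) ^ J.card • F J (K - Pi.single i 1) l else 0

/-- Left multiplication by a covector. -/
def mulCovector (α : V →L[ℝ] ℝ) (F : Fib ι V) : Fib ι V := fun J K l =>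
  match l with
  | 0 => 0
  | l + 1 => (-1 : ℝ) ^ (∑ i, K i) • wedge α (F J K l)

/-- The alternating forms, as the subalgebra of elements without `E_i` and `dE_i`. -/
def ofForm (η : ∀ l : ℕ, V [⋀^Fin l]→L[ℝ] ℝ) : Fib ι V := fun J K l =>
  if J = ∅ ∧ K = 0 then η l else 0

/-- An alternating form of degree `k`, as an element of the fibre algebra. -/
def ofDegree {k : ℕ} (η : V [⋀^Fin k]→L[ℝ] ℝ) : Fib ι V :=
  ofForm (Pi.single k η)

/-- Left multiplication by `∑ a, c a i * E_a`. -/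
def mulPullE (c : ι → ι → ℝ) (i : ι) (F : Fib ι V) : Fib ι V :=
  ∑ a, c a i • mulE a F

/-- Left multiplication by `∑ a, (dc a i * E_a + c a i * dE_a)`. -/
def mulPullDE (c : ι → ι → ℝ) (dc : ι → ι → V →L[ℝ] ℝ) (i : ι) (F : Fib ι V) : Fib ι V :=
  ∑ a, (mulCovector (dc a i) (mulE a F) + c a i • mulDE a F)

/-- The homomorphism of fibre algebras which on alternating forms is the pullback along the
linear map `A` and which sends `E_i` to `∑ a, c a i * E_a` and `dE_i` to
`∑ a, (dc a i * E_a + c a i * dE_a)`.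
The sum over `K` is finite in each component: the image of each factor `dE_i` is of total
degree one in the `E_a` and `dE_a`. -/
def fibPull (A : V' →L[ℝ] V) (c : ι → ι → ℝ) (dc : ι → ι → V' →L[ℝ] ℝ) (F : Fib ι V) :
    Fib ι V' := fun J' K' l' =>
  ∑ J : Finset ι, ∑ᶠ K : ι → ℕ,
    ((J.sort (· ≤ ·)).foldr (mulPullE c)
      ((Finset.univ.sort (· ≤ ·)).foldr (fun i => (mulPullDE c dc i)^[K i])
        (ofForm fun l => (F J K l).compContinuousLinearMap A))) J' K' l'

end Fibre

/-! ### Differential forms on the graded manifold `N × 𝔤*[-1]`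

Its functions are `C^∞(N) ⊗ Λ𝔤` with `𝔤` in degree `-1`; the homological vector field is the
contraction with a map `N → 𝔤*`, with components `μ i : N → ℝ` in a basis of `𝔤*`.
Its differential forms are the sections of the algebras `Fib ι (T_x N)`. -/

section GradedForms

variable {ι : Type*} [Fintype ι] [LinearOrder ι]
  {E : Type*} [NormedAddCommGroup E] [NormedSpace ℝ E]
  {H : Type*} [TopologicalSpace H] (I : ModelWithCorners ℝ E H)
  {N : Type*} [TopologicalSpace N] [ChartedSpace H N]
  {E' : Type*} [NormedAddCommGroup E'] [NormedSpace ℝ E']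
  {H' : Type*} [TopologicalSpace H'] (I' : ModelWithCorners ℝ E' H')
  {N' : Type*} [TopologicalSpace N'] [ChartedSpace H' N']

/-- The de Rham differential: the derivation of bidegree `(1, 0)` which is the exterior derivative
on forms on `N` and sends `E_i` to `dE_i` and `dE_i` to `0`. -/
def deRham (F : N → Fib ι E) : N → Fib ι E := fun x J K l =>
  (∑ i, if i ∉ J ∧ 0 < K i then
      (-1 : ℝ) ^ (J.filter (i < ·)).card • F x (insert i J) (K - Pi.single i 1) l else 0) +
  (match l with
    | 0 => 0
    | l + 1 => (-1 : ℝ) ^ (∑ i, K i) • extD I (fun y => F y J K l) x)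

/-- The internal differential: the derivation of bidegree `(0, 1)` which vanishes on forms on `N`
and sends `E_i` to `μ i` and `dE_i` to the differential of `μ i`. -/
def internal (μ : ι → N → ℝ) (F : N → Fib ι E) : N → Fib ι E := fun x J K l =>
  (∑ i, if i ∉ J then
      (-1 : ℝ) ^ (J.filter (· < i)).card • μ i x • F x (insert i J) K l else 0) +
  (match l with
    | 0 => 0
    | l + 1 => ∑ i, ((-1 : ℝ) ^ (J.card + ∑ a, K a) * ((K i : ℝ) + 1)) •
        wedge (differential I (μ i) x) (F x J (K + Pi.single i 1) l))

/-- The pullback along the map of graded manifolds given by `f` on the underlying manifolds and by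
`E_i ↦ ∑ a, c a i * E_a` on the generators of degree `-1`; it sends `dE_i` to
`d (∑ a, c a i * E_a)`. -/
def gradedPull (f : N' → N) (c : ι → ι → N' → ℝ) (F : N → Fib ι E) : N' → Fib ι E' := fun x =>
  fibPull (tangentMapAt I I' f x) (fun a i => c a i x)
    (fun a i => differential I' (c a i) x) (F (f x))

end GradedForms

/-! ### The powers `G ^ r` as manifolds -/

section Powers

/-- The model vector space of `G ^ r`. -/
def PowE (E : Type u) : ℕ → Type u
  | 0 => PUnit
  | r + 1 => E × PowE E r

/-- The model space of `G ^ r`. -/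
def PowH (H : Type u) : ℕ → Type u
  | 0 => PUnit
  | r + 1 => ModelProd H (PowH H r)

/-- The `r`-fold product `G × (G × ⋯)`. -/
def Pow (G : Type u) : ℕ → Type u
  | 0 => PUnit
  | r + 1 => G × Pow G r

instance instNormedAddCommGroupPowE (E : Type u) [NormedAddCommGroup E] :
    ∀ r, NormedAddCommGroup (PowE E r)
  | 0 => inferInstanceAs (NormedAddCommGroup PUnit)
  | r + 1 =>
    letI := instNormedAddCommGroupPowE E r
    inferInstanceAs (NormedAddCommGroup (E × PowE E r))

instance instNormedSpacePowE (E : Type u) [NormedAddCommGroup E] [NormedSpace ℝ E] :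
    ∀ r, NormedSpace ℝ (PowE E r)
  | 0 => inferInstanceAs (NormedSpace ℝ PUnit)
  | r + 1 =>
    letI := instNormedSpacePowE E r
    inferInstanceAs (NormedSpace ℝ (E × PowE E r))

instance instTopologicalSpacePowH (H : Type u) [TopologicalSpace H] :
    ∀ r, TopologicalSpace (PowH H r)
  | 0 => inferInstanceAs (TopologicalSpace PUnit)
  | r + 1 =>
    letI := instTopologicalSpacePowH H r
    inferInstanceAs (TopologicalSpace (ModelProd H (PowH H r)))

instance instTopologicalSpacePow (G : Type u) [TopologicalSpace G] :
    ∀ r, TopologicalSpace (Pow G r)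
  | 0 => inferInstanceAs (TopologicalSpace PUnit)
  | r + 1 =>
    letI := instTopologicalSpacePow G r
    inferInstanceAs (TopologicalSpace (G × Pow G r))

instance instChartedSpacePow (H : Type v) [TopologicalSpace H] (G : Type u) [TopologicalSpace G]
    [ChartedSpace H G] : ∀ r, ChartedSpace (PowH H r) (Pow G r)
  | 0 =>
    haveI : DiscreteTopology (Pow G 0) := inferInstanceAs (DiscreteTopology PUnit)
    letI : Unique (PowH H 0) := inferInstanceAs (Unique PUnit)
    ChartedSpace.ofDiscreteTopology
  | r + 1 =>
    letI := instChartedSpacePow H G r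
    inferInstanceAs (ChartedSpace (ModelProd H (PowH H r)) (G × Pow G r))

/-- The model with corners of a point. -/
def pointModel : ModelWithCorners ℝ PUnit.{u + 1} PUnit.{v + 1} :=
  ModelWithCorners.ofTargetUniv ℝ
    { toFun := fun _ => PUnit.unit
      invFun := fun _ => PUnit.unit
      source := Set.univ
      target := Set.univ
      map_source' := fun _ _ => trivial
      map_target' := fun _ _ => trivial
      left_inv' := fun _ _ => rfl
      right_inv' := fun _ _ => rfl }
    rfl rfl continuous_const continuous_const

/-- The model with corners of `G ^ r`. -/
def powModel {E : Type u} [NormedAddCommGroup E] [NormedSpace ℝ E] {H : Type v}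
    [TopologicalSpace H] (I : ModelWithCorners ℝ E H) :
    ∀ r, ModelWithCorners ℝ (PowE E r) (PowH H r)
  | 0 => pointModel
  | r + 1 => I.prod (powModel I r)

end Powers

/-! ### The action groupoid of the derived zero set and its Bott–Shulman complex -/

section Action

variable {EG : Type*} [NormedAddCommGroup EG] [NormedSpace ℝ EG]
  {HG : Type*} [TopologicalSpace HG] (IG : ModelWithCorners ℝ EG HG)
  {G : Type*} [TopologicalSpace G] [ChartedSpace HG G] [Group G]
  {EM : Type*} [NormedAddCommGroup EM] [NormedSpace ℝ EM]
  {HM : Type*} [TopologicalSpace HM] (IM : ModelWithCorners ℝ EM HM)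
  {M : Type*} [TopologicalSpace M] [ChartedSpace HM M] [MulAction G M]

/-- The adjoint action of `g` on the Lie algebra: the derivative at `1` of the conjugation
by `g`. -/
def Ad (g : G) : GroupLieAlgebra IG G →ₗ[ℝ] GroupLieAlgebra IG G :=
  (tangentMapAt IG IG (fun h : G => g * h * g⁻¹) 1 : EG →L[ℝ] EG).toLinearMap

/-- The value at `m` of the vector field generated by `X`, the derivative of `g ↦ g • m`
at `1` in the direction `X`. -/
def infinitesimalAction (X : GroupLieAlgebra IG G) (m : M) : EM :=
  tangentMapAt IM IG (fun g : G => g • m) 1 X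

/-- The left Maurer–Cartan form: the value at `g` translates a tangent vector at `g` to `1` by the
left multiplication by `g⁻¹`. -/
def maurerCartan (g : G) : EG →L[ℝ] GroupLieAlgebra IG G :=
  (tangentMapAt IG IG (fun h : G => g⁻¹ * h) g : EG →L[ℝ] EG)

/-- A symplectic form: smooth, closed and nondegenerate. -/
structure IsSymplectic (Ω : M → EM [⋀^Fin 2]→L[ℝ] ℝ) : Prop where
  smooth : IsSmoothForm IM Ω
  closed : extD IM Ω = 0
  nondegenerate : ∀ (m : M) (v : EM), (∀ w : EM, Ω m ![v, w] = 0) → v = 0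

/-- The action of `G` on `(M, Ω)` is Hamiltonian with equivariant moment map `μ`. -/
structure IsHamiltonian (Ω : M → EM [⋀^Fin 2]→L[ℝ] ℝ)
    (μ : M → Module.Dual ℝ (GroupLieAlgebra IG G)) : Prop where
  invariant : ∀ g : G, pullForm IM IM (fun m : M => g • m) Ω = Ω
  smooth : ∀ X : GroupLieAlgebra IG G, ContMDiff IM 𝓘(ℝ, ℝ) ∞ fun m => μ m X
  equivariant : ∀ (g : G) (m : M) (X : GroupLieAlgebra IG G), μ (g • m) X = μ m (Ad IG g⁻¹ X)
  hamilton : ∀ (X : GroupLieAlgebra IG G) (m : M) (v : EM),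
    Ω m ![infinitesimalAction IG IM X m, v] = differential IM (fun m' => μ m' X) m v

/-- The face maps `G ^ (r + 1) × M → G ^ r × M`: the `0`-th one drops the first factor, the `k`-th
one, `1 ≤ k ≤ r`, multiplies the `k`-th and the `(k + 1)`-th factor, and the `(r + 1)`-th one lets
the last factor act on `M`. -/
def face : ∀ r : ℕ, ℕ → Pow G (r + 1) × M → Pow G r × M
  | 0, 0 => fun y => (y.1.2, y.2)
  | 0, _ + 1 => fun y => (y.1.2, y.1.1 • y.2)
  | _ + 1, 0 => fun y => (y.1.2, y.2)
  | _ + 1, 1 => fun y => ((y.1.1 * y.1.2.1, y.1.2.2), y.2)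
  | r + 1, k + 2 => fun y =>
    ((y.1.1, (face r (k + 1) (y.1.2, y.2)).1), (face r (k + 1) (y.1.2, y.2)).2)

/-- The last factor of an element of `G ^ (r + 1)`. -/
def lastFactor : ∀ r : ℕ, Pow G (r + 1) → G
  | 0 => fun y => y.1
  | r + 1 => fun y => lastFactor r y.2

variable {ι : Type*} [Fintype ι] [LinearOrder ι] (b : Module.Basis ι ℝ (GroupLieAlgebra IG G))

/-- The effect of the `k`-th face map on the generators of degree `-1`, as a matrix in the
basis `b`: the last face map sends `X` to `Ad g⁻¹ X` with `g` the last factor,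
the others fix the generators. -/
def faceMatrix (r k : ℕ) (a i : ι) (y : Pow G (r + 1) × M) : ℝ :=
  if k = r + 1 then b.repr (Ad IG (lastFactor r y.1)⁻¹ (b i)) a else if a = i then 1 else 0

variable (EG EM G M ι) in
/-- Families of components of the differential forms on the graded manifolds `G ^ r × Z`, for all
`r` and without condition of smoothness. -/
abbrev Total : Type _ := ∀ r : ℕ, Pow G r × M → Fib ι (PowE EG r × EM)

/-- The form degree of a term `E_J * dE_K * η`, with `η` a form of degree `l`. -/
def formDegree (_J : Finset ι) (K : ι → ℕ) (l : ℕ) : ℤ := l + ∑ i, (K i : ℤ)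

/-- The derived degree of a term `E_J * dE_K * η`, with `η` a form of degree `l`. -/
def derivedDegree (J : Finset ι) (K : ι → ℕ) (_l : ℕ) : ℤ := -(J.card + ∑ i, (K i : ℤ))

/-- The elements of total degree `m` of the de Rham complex of the action groupoid: the families
of smooth forms on `G ^ r × Z`, of form degree `p` and derived degree `q`, over all
`p + r + q = m`. -/
def DR (m : ℤ) : Set (Total EG G EM M ι) :=
  {F | (∀ (r : ℕ) J K l, IsSmoothForm ((powModel IG r).prod IM) fun y => F r y J K l) ∧
    ∀ (r : ℕ) J K l, formDegree J K l + r + derivedDegree J K l ≠ m → ∀ y, F r y J K l = 0}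

/-- The de Rham differential. -/
def totalDeRham (F : Total EG G EM M ι) : Total EG G EM M ι := fun r =>
  deRham ((powModel IG r).prod IM) (F r)

/-- The internal differential, the contraction with the moment map. -/
def totalInternal (μ : M → Module.Dual ℝ (GroupLieAlgebra IG G)) (F : Total EG G EM M ι) :
    Total EG G EM M ι := fun r =>
  internal ((powModel IG r).prod IM) (fun i y => μ y.2 (b i)) (F r)

/-- The pullback of forms along the `k`-th face map `G ^ (r + 1) × Z → G ^ r × Z`. -/
def facePull (r k : ℕ) (F : Pow G r × M → Fib ι (PowE EG r × EM)) :
    Pow G (r + 1) × M → Fib ι (PowE EG (r + 1) × EM) :=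
  gradedPull ((powModel IG r).prod IM) ((powModel IG (r + 1)).prod IM) (face r k)
    (faceMatrix IG b r k) F

/-- The simplicial differential, the alternating sum of the pullbacks along the face maps. -/
def totalSimplicial (F : Total EG G EM M ι) : Total EG G EM M ι
  | 0 => 0
  | r + 1 => ∑ k ∈ Finset.range (r + 2), (-1 : ℝ) ^ k • facePull IG IM b r k (F r)

/-- The total differential `d + (-1) ^ p ι_μ + ε (-1) ^ (p + q) ∂^*`, where `p` and `q` are the
form degree and the derived degree of the argument, for a sign `ε`. The operators `ι_μ`
and `∂^*` preserve `p`, and `∂^*` preserves `q`. -/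
def totalD (μ : M → Module.Dual ℝ (GroupLieAlgebra IG G)) (ε : ℤˣ) (F : Total EG G EM M ι) :
    Total EG G EM M ι := fun r y J K l =>
  totalDeRham IG IM F r y J K l +
    ((formDegree J K l).negOnePow : ℤ) • totalInternal IG IM b μ F r y J K l +
    ((ε * (formDegree J K l + derivedDegree J K l).negOnePow : ℤˣ) : ℤ) •
      totalSimplicial IG IM b F r y J K l

/-- The pullback to `Z` of a 2-form on `M`, in simplicial degree `0`. -/
def iotaForm (Ω : M → EM [⋀^Fin 2]→L[ℝ] ℝ) : Total EG G EM M ι :=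
  Pi.single 0 fun y =>
    ofDegree (pullForm IM ((powModel IG 0).prod IM) (fun z : Pow G 0 × M => z.2) Ω y)

/-- The `i`-th coordinate of the Lie algebra in the basis `b`, as a linear function on the
model vector space. -/
def coord (i : ι) : EG →ₗ[ℝ] ℝ := b.coord i

variable [FiniteDimensional ℝ EG]

/-- The `i`-th coordinate of the Lie algebra in the basis `b`, as a continuous linear function on
the model vector space. -/
def coordCovector (i : ι) : EG →L[ℝ] ℝ := LinearMap.toContinuousLinearMap (coord IG b i)

/-- The `i`-th component of the left Maurer–Cartan form in the basis `b`, a 1-form on `G`. -/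
def maurerCartanCoord (i : ι) (g : G) : EG [⋀^Fin 1]→L[ℝ] ℝ :=
  ContinuousAlternatingMap.ofSubsingleton ℝ EG ℝ (0 : Fin 1)
    ((coordCovector IG b i).comp
      (maurerCartan IG g : EG →L[ℝ] EG))

/-- The left Maurer–Cartan form `θ = ∑ i, E_i * θ_i`, with `θ_i` its components in the basis `b`,
pulled back to `G × Z`, in simplicial degree `1`. -/
def thetaForm : Total EG G EM M ι :=
  Pi.single 1 fun y => ∑ i, mulE i (ofDegree
    (pullForm IG ((powModel IG 1).prod IM) (fun z : Pow G 1 × M => z.1.1)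
      (maurerCartanCoord IG b i) y))

variable (M) in
/-- The 2-form `dθ`, the de Rham differential of the Maurer–Cartan form `θ` on `G × Z`. -/
def dTheta : Total EG G EM M ι :=
  totalDeRham IG IM (thetaForm IG IM b)

/-- The reduced form, the sum of the pullback of `Ω` to `Z` and of `dθ`. -/
def reducedForm (Ω : M → EM [⋀^Fin 2]→L[ℝ] ℝ) : Total EG G EM M ι :=
  iotaForm IG IM Ω + dTheta IG IM M b

end Action

end BottShulman

end

set_option linter.unusedSectionVars false

noncomputable section

namespace BottShulman

open Filter Set Topology

universe u v

/-! ### Smooth families of alternating forms -/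

section AlternatingSmooth

variable {E : Type*} [NormedAddCommGroup E] [NormedSpace ℝ E]
  {E' : Type*} [NormedAddCommGroup E'] [NormedSpace ℝ E']
  {X : Type*} [NormedAddCommGroup X] [NormedSpace ℝ X]

/-! The geometric content lies in two identities, one on `G × M` and one on `G × G`.

First, write `X♯` for the vector field generated by `X`, `μ_i = ⟨μ, b_i⟩` and `θ_i` for the
components of the Maurer–Cartan form. The action map sends a tangent vector `(v, u)` at `(g, m)` to
the translate by `g` of `X♯ + u`, with `X = θ(v)` (`tangentMapAt_smul`). By invariance of `ω`, with
`Y = θ(w)`, the difference `s^*ω - t^*ω` on `(v, u)`, `(w, u')` is therefore `-ω(X♯, Y♯) - ω(X♯, u')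
- ω(u, Y♯)`. By Hamilton's equation the mixed terms are `∑ dμ_i ∧ θ_i`, and the remaining term is `∑
μ_i dθ_i`; together they are `ι_μ dθ` (`pullForm_sub_pullForm_smul`).

The equality `∑ μ_i dθ_i = -ω(X♯, Y♯)` is obtained without Lie brackets. Pulling `θ` back along the
constant map `g ↦ g g⁻¹` and differentiating at `1` gives `2 dθ_i = -∑_j d(Ad)_ij ∧ θ_j`
(`two_smul_extD_maurerCartanCoord_one`). Differentiating the equivariance of `μ` gives `∑_i μ_i
d(Ad)_ij(Y) = -ω(b_j♯, Y♯)` (`sum_moment_differential_adMatrix`). Combining the two proves the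
equality at `1`, and left invariance of `dθ` carries it to every `g`
(`sum_moment_extD_maurerCartanCoord`).

Second, `θ` is multiplicative: its pullback along `(g, h) ↦ gh` is `Ad_{h⁻¹}` of the first pullback
plus the second (`pullForm_mul_maurerCartanCoord`). The last face map twists the generators by
exactly this `Ad_{h⁻¹}`, so the alternating sum of the three pullbacks of `θ` vanishes, and that of
`dθ` does too because pullback commutes with `d` (`sum_facePull_lin_extD_thetaCoord`).

Closedness is then read off in each simplicial degree: `dω = 0` and `ι_μ ω = 0` in degree 0, `d dθ =
0` and the first identity in degree 1, the second identity in degree 2. The total sign of `dθ` and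
the sign of `∂^*` must be opposite (`totalD_eq_zero`).

All these computations involve only pure forms (`ofDegree`) and elements linear in the generators
(`lin`), so the operators on the fibre algebra need to be evaluated on these two kinds of elements
only. -/

instance finiteDimensional_continuousAlternatingMap [FiniteDimensional ℝ E] (l : ℕ) :
    FiniteDimensional ℝ (E [⋀^Fin l]→L[ℝ] ℝ) := by
  let e := Module.finBasis ℝ E
  let Φ : (E [⋀^Fin l]→L[ℝ] ℝ) →ₗ[ℝ] ((Fin l → Fin (Module.finrank ℝ E)) → ℝ) :=
    { toFun := fun f k => f fun i => e (k i)
      map_add' := fun _ _ => rfl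
      map_smul' := fun _ _ => rfl }
  refine FiniteDimensional.of_injective Φ fun f g h => ?_
  refine ContinuousAlternatingMap.toAlternatingMap_injective ?_
  exact e.ext_alternating fun v _ => congrFun h v

/-- A map into the alternating forms of a finite-dimensional space is smooth as soon as its values
on all fixed vectors are. -/
theorem contDiffAt_alternating_of_apply [FiniteDimensional ℝ E] {l : ℕ} {x : X}
    {f : X → E [⋀^Fin l]→L[ℝ] ℝ} (h : ∀ v, ContDiffAt ℝ ∞ (fun y => f y v) x) :
    ContDiffAt ℝ ∞ f x := by
  let e := Module.finBasis ℝ E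
  let Φ : (E [⋀^Fin l]→L[ℝ] ℝ) →ₗ[ℝ] ((Fin l → Fin (Module.finrank ℝ E)) → ℝ) :=
    { toFun := fun f k => f fun i => e (k i)
      map_add' := fun _ _ => rfl
      map_smul' := fun _ _ => rfl }
  have hΦ : Function.Injective Φ := fun f g h =>
    ContinuousAlternatingMap.toAlternatingMap_injective
      (e.ext_alternating fun v _ => congrFun h v)
  -- A linear left inverse of `Φ` has finite-dimensional source, hence is continuous; `f` is `Ψ`
  -- applied to finitely many smooth functions.
  obtain ⟨Ψ, hΨ⟩ := LinearMap.exists_leftInverse_of_injective Φ (LinearMap.ker_eq_bot.2 hΦ)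
  have h1 : ContDiffAt ℝ ∞ (fun y => Φ (f y)) x := contDiffAt_pi.2 fun k => h _
  have h2 := (LinearMap.toContinuousLinearMap Ψ).contDiff.contDiffAt.comp x h1
  refine h2.congr_of_eventuallyEq (Eventually.of_forall fun y => ?_)
  exact (LinearMap.congr_fun hΨ (f y)).symm

/-- Induction on the degree: currying feeds in the first vector by a continuous linear evaluation
and lowers the degree by one. -/
theorem ContDiffAt.alternating_apply {l : ℕ} {x : X} {f : X → E [⋀^Fin l]→L[ℝ] ℝ}
    {v : X → Fin l → E} (hf : ContDiffAt ℝ ∞ f x) (hv : ∀ i, ContDiffAt ℝ ∞ (fun y => v y i) x) :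
    ContDiffAt ℝ ∞ (fun y => f y (v y)) x := by
  induction l with
  | zero =>
    have h := (ContinuousAlternatingMap.apply ℝ E ℝ (ι := Fin 0) ![]).contDiff.contDiffAt.comp x hf
    refine h.congr_of_eventuallyEq (Eventually.of_forall fun y => ?_)
    exact congrArg (f y) (Subsingleton.elim _ _)
  | succ l ih =>
    have hc : ContDiff ℝ ∞ ⇑(ContinuousAlternatingMap.curryLeftLI (𝕜 := ℝ) (E := E) (F := ℝ)
        (n := l)) := LinearIsometry.contDiff _
    have h0 : ContDiffAt ℝ ∞ (fun y => (f y).curryLeft) x := hc.contDiffAt.comp x hf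
    have h1 : ContDiffAt ℝ ∞ (fun y => (f y).curryLeft (v y 0)) x := h0.clm_apply (hv 0)
    refine (ih h1 (v := fun y i => v y i.succ) fun i => hv _).congr_of_eventuallyEq
      (Eventually.of_forall fun y => ?_)
    simp only [ContinuousAlternatingMap.curryLeft_apply_apply]
    exact congrArg (f y) (Fin.cons_self_tail (v y)).symm

theorem ContDiffAt.alternating_comp [FiniteDimensional ℝ E'] {l : ℕ} {x : X}
    {f : X → E [⋀^Fin l]→L[ℝ] ℝ} {A : X → E' →L[ℝ] E}
    (hf : ContDiffAt ℝ ∞ f x) (hA : ContDiffAt ℝ ∞ A x) :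
    ContDiffAt ℝ ∞ (fun y => (f y).compContinuousLinearMap (A y)) x :=
  contDiffAt_alternating_of_apply fun v =>
    ContDiffAt.alternating_apply (v := fun y i => A y (v i)) hf
      fun _ => hA.clm_apply contDiffAt_const

end AlternatingSmooth

/-! ### Exterior product with a covector -/

section Wedge

variable {V : Type*} [NormedAddCommGroup V] [NormedSpace ℝ V]
  {V' : Type*} [NormedAddCommGroup V'] [NormedSpace ℝ V']

theorem wedge_apply (α : V →L[ℝ] ℝ) {l : ℕ} (η : V [⋀^Fin l]→L[ℝ] ℝ) (v : Fin (l + 1) → V) :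
    wedge α η v = ∑ i : Fin (l + 1), (-1 : ℝ) ^ (i : ℕ) * (α (v i) * η (i.removeNth v)) := by
  simp [wedge, ContinuousAlternatingMap.alternatizeUncurryFin_apply]

theorem wedge_comp (α : V →L[ℝ] ℝ) {l : ℕ} (η : V [⋀^Fin l]→L[ℝ] ℝ) (A : V' →L[ℝ] V) :
    (wedge α η).compContinuousLinearMap A =
      wedge (α.comp A) (η.compContinuousLinearMap A) := by
  ext v
  simp only [wedge_apply, ContinuousAlternatingMap.compContinuousLinearMap_apply]
  rfl

@[simp] theorem wedge_zero (α : V →L[ℝ] ℝ) {l : ℕ} :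
    wedge α (0 : V [⋀^Fin l]→L[ℝ] ℝ) = 0 := by
  ext v
  simp [wedge_apply]

theorem wedge_smul (α : V →L[ℝ] ℝ) {l : ℕ} (c : ℝ) (η : V [⋀^Fin l]→L[ℝ] ℝ) :
    wedge α (c • η) = c • wedge α η := by
  ext v
  simp only [wedge_apply, ContinuousAlternatingMap.smul_apply, smul_eq_mul, Finset.mul_sum]
  exact Finset.sum_congr rfl fun i _ => by ring

end Wedge

/-! ### Chain rules on model vector spaces -/

section TangentMaps

variable {E : Type*} [NormedAddCommGroup E] [NormedSpace ℝ E]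
  {H : Type*} [TopologicalSpace H] {I : ModelWithCorners ℝ E H}
  {N : Type*} [TopologicalSpace N] [ChartedSpace H N]
  {E' : Type*} [NormedAddCommGroup E'] [NormedSpace ℝ E']
  {H' : Type*} [TopologicalSpace H'] {I' : ModelWithCorners ℝ E' H'}
  {N' : Type*} [TopologicalSpace N'] [ChartedSpace H' N']
  {E'' : Type*} [NormedAddCommGroup E''] [NormedSpace ℝ E'']
  {H'' : Type*} [TopologicalSpace H''] {I'' : ModelWithCorners ℝ E'' H''}
  {N'' : Type*} [TopologicalSpace N''] [ChartedSpace H'' N'']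

theorem tangentMapAt_comp {g : N' → N} {f : N'' → N'} (x : N'')
    (hg : MDifferentiableAt I' I g (f x)) (hf : MDifferentiableAt I'' I' f x) :
    tangentMapAt I I'' (fun y => g (f y)) x =
      (tangentMapAt I I' g (f x)).comp (tangentMapAt I' I'' f x) :=
  mfderiv_comp x hg hf

theorem tangentMapAt_congr {f g : N' → N} {x : N'} (h : f =ᶠ[𝓝 x] g) :
    tangentMapAt I I' f x = tangentMapAt I I' g x :=
  h.mfderiv_eq

theorem tangentMapAt_id (x : N) : tangentMapAt I I (fun y => y) x = ContinuousLinearMap.id ℝ E :=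
  mfderiv_id

theorem tangentMapAt_const (c : N) (x : N') : tangentMapAt I I' (fun _ => c) x = 0 :=
  mfderiv_const

theorem tangentMapAt_eq_fderiv (f : E' → E) (x : E') :
    tangentMapAt 𝓘(ℝ, E) 𝓘(ℝ, E') f x = fderiv ℝ f x :=
  mfderiv_eq_fderiv

theorem mdifferentiableAt_of_contMDiffAt {f : N' → N} {x : N'} (h : ContMDiffAt I' I ∞ f x) :
    MDifferentiableAt I' I f x :=
  h.mdifferentiableAt (by simp)

theorem differential_comp {g : N' → ℝ} {f : N'' → N'} (x : N'')
    (hg : MDifferentiableAt I' 𝓘(ℝ, ℝ) g (f x)) (hf : MDifferentiableAt I'' I' f x) :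
    differential I'' (fun y => g (f y)) x =
      (differential I' g (f x)).comp (tangentMapAt I' I'' f x) :=
  mfderiv_comp x hg hf

section Charts

variable [IsManifold I ∞ N]

/-- Without boundary the chart target is open, so smoothness on it is smoothness at each of its
points. -/
theorem contMDiffAt_extChartAt_symm' [I.Boundaryless] {x₀ : N} {y : E} (hy : y ∈ (extChartAt I x₀).target) :
    ContMDiffAt 𝓘(ℝ, E) I ∞ (extChartAt I x₀).symm y :=
  (contMDiffOn_extChartAt_symm x₀).contMDiffAt ((isOpen_extChartAt_target x₀).mem_nhds hy)

theorem contMDiffAt_extChartAt_of_mem {x₀ x : N} (hx : x ∈ (extChartAt I x₀).source) :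
    ContMDiffAt I 𝓘(ℝ, E) ∞ (extChartAt I x₀) x :=
  contMDiffAt_extChartAt' (by simpa using hx)

end Charts

end TangentMaps

/-! ### Pullback and exterior derivative of forms on manifolds -/

section FormCalculus

variable {E : Type*} [NormedAddCommGroup E] [NormedSpace ℝ E]
  {H : Type*} [TopologicalSpace H] {I : ModelWithCorners ℝ E H} [I.Boundaryless]
  {N : Type*} [TopologicalSpace N] [ChartedSpace H N] [IsManifold I ∞ N]
  {E' : Type*} [NormedAddCommGroup E'] [NormedSpace ℝ E']
  {H' : Type*} [TopologicalSpace H'] {I' : ModelWithCorners ℝ E' H'} [I'.Boundaryless]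
  {N' : Type*} [TopologicalSpace N'] [ChartedSpace H' N'] [IsManifold I' ∞ N']

theorem minSmoothness_two_le : minSmoothness ℝ 2 ≤ ∞ := by
  rw [minSmoothness_of_isRCLikeNormedField]
  exact WithTop.coe_le_coe.2 le_top

/-- The local representative of a map in preferred charts. -/
def localRep (I : ModelWithCorners ℝ E H) (I' : ModelWithCorners ℝ E' H') (f : N' → N) (x₀' : N')
    (x₀ : N) (z : E') : E :=
  extChartAt I x₀ (f ((extChartAt I' x₀').symm z))

omit [I.Boundaryless] in
theorem contDiffAt_localRep {f : N' → N} {x₀' : N'} {x₀ : N} {y : E'}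
    (hf : ContMDiffAt I' I ∞ f ((extChartAt I' x₀').symm y))
    (hy : y ∈ (extChartAt I' x₀').target)
    (hfy : f ((extChartAt I' x₀').symm y) ∈ (extChartAt I x₀).source) :
    ContDiffAt ℝ ∞ (localRep I I' f x₀' x₀) y := by
  refine ContMDiffAt.contDiffAt ?_
  exact (contMDiffAt_extChartAt_of_mem hfy).comp y
    (hf.comp y (contMDiffAt_extChartAt_symm' hy))

/-- In charts, the pullback of a form is the pullback along the local representative. -/
theorem chartRep_pullForm {l : ℕ} {f : N' → N} (η : N → E [⋀^Fin l]→L[ℝ] ℝ)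
    {x₀' : N'} {x₀ : N} {y : E'}
    (hf : ContMDiffAt I' I ∞ f ((extChartAt I' x₀').symm y))
    (hy : y ∈ (extChartAt I' x₀').target)
    (hfy : f ((extChartAt I' x₀').symm y) ∈ (extChartAt I x₀).source) :
    chartRep I' (pullForm I I' f η) x₀' y =
      (chartRep I η x₀ (localRep I I' f x₀' x₀ y)).compContinuousLinearMap
        (fderiv ℝ (localRep I I' f x₀' x₀) y) := by
  have hs := contMDiffAt_extChartAt_symm' (I := I') hy
  have hg : ContDiffAt ℝ ∞ (localRep I I' f x₀' x₀) y := contDiffAt_localRep hf hy hfy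
  have hfs := hf.comp y hs
  have ht : localRep I I' f x₀' x₀ y ∈ (extChartAt I x₀).target :=
    (extChartAt I x₀).map_source hfy
  have hinv : (extChartAt I x₀).symm (localRep I I' f x₀' x₀ y) =
      f ((extChartAt I' x₀').symm y) := (extChartAt I x₀).left_inv hfy
  have h1 := tangentMapAt_comp (I := I) (I' := I') (I'' := 𝓘(ℝ, E')) (g := f)
    (f := (extChartAt I' x₀').symm) y (mdifferentiableAt_of_contMDiffAt hf)
    (mdifferentiableAt_of_contMDiffAt hs)
  have h2 := tangentMapAt_comp (I := I) (I' := 𝓘(ℝ, E)) (I'' := 𝓘(ℝ, E'))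
    (g := (extChartAt I x₀).symm)
    (f := localRep I I' f x₀' x₀) y
    (mdifferentiableAt_of_contMDiffAt (contMDiffAt_extChartAt_symm' ht))
    (mdifferentiableAt_of_contMDiffAt hg.contMDiffAt)
  -- Both composites are `f` read in the source chart alone; comparing their chain rules relates the
  -- derivative of the local representative to that of `f`.
  have h3 : (fun z => (extChartAt I x₀).symm (localRep I I' f x₀' x₀ z)) =ᶠ[𝓝 y]
      fun z => f ((extChartAt I' x₀').symm z) := by
    have : ∀ᶠ z in 𝓝 y, f ((extChartAt I' x₀').symm z) ∈ (extChartAt I x₀).source :=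
      hfs.continuousAt.eventually_mem ((isOpen_extChartAt_source x₀).mem_nhds hfy)
    filter_upwards [this] with z hz using (extChartAt I x₀).left_inv hz
  rw [tangentMapAt_congr h3, h1, tangentMapAt_eq_fderiv] at h2
  ext v
  simp only [chartRep, pullForm, ContinuousAlternatingMap.compContinuousLinearMap_apply, hinv]
  congr 1
  funext i
  exact DFunLike.congr_fun h2 (v i)

theorem eventually_chartRep_pullForm {l : ℕ} {f : N' → N} (hf : ContMDiff I' I ∞ f)
    (η : N → E [⋀^Fin l]→L[ℝ] ℝ) {x₀' : N'} {x₀ : N} {y : E'}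
    (hy : y ∈ (extChartAt I' x₀').target)
    (hfy : f ((extChartAt I' x₀').symm y) ∈ (extChartAt I x₀).source) :
    ∀ᶠ z in 𝓝 y, chartRep I' (pullForm I I' f η) x₀' z =
      (chartRep I η x₀ (localRep I I' f x₀' x₀ z)).compContinuousLinearMap
        (fderiv ℝ (localRep I I' f x₀' x₀) z) := by
  have h : ∀ᶠ z in 𝓝 y, f ((extChartAt I' x₀').symm z) ∈ (extChartAt I x₀).source :=
    ((hf _).comp y (contMDiffAt_extChartAt_symm' hy)).continuousAt.eventually_mem
      ((isOpen_extChartAt_source x₀).mem_nhds hfy)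
  filter_upwards [h, (isOpen_extChartAt_target x₀').mem_nhds hy] with z hz hz'
  exact chartRep_pullForm η (hf _) hz' hz

omit [IsManifold I ∞ N] in
theorem IsSmoothForm.contDiffAt {l : ℕ} {η : N → E [⋀^Fin l]→L[ℝ] ℝ} (h : IsSmoothForm I η)
    {x₀ : N} {y : E} (hy : y ∈ (extChartAt I x₀).target) :
    ContDiffAt ℝ ∞ (chartRep I η x₀) y :=
  (h x₀).contDiffAt ((isOpen_extChartAt_target x₀).mem_nhds hy)

theorem contDiffAt_fderiv_infty {g : E' → E} {y : E'} (hg : ContDiffAt ℝ ∞ g y) :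
    ContDiffAt ℝ ∞ (fderiv ℝ g) y :=
  hg.fderiv_right (by simp)

/-- The chart at `x₀` is arbitrary and only one point is involved, so that the case `f = id` is a
change of chart. -/
theorem contDiffAt_chartRep_pullForm [FiniteDimensional ℝ E'] {l : ℕ} {f : N' → N}
    (hf : ContMDiff I' I ∞ f) {η : N → E [⋀^Fin l]→L[ℝ] ℝ} {x₀' : N'} {x₀ : N} {y : E'}
    (hy : y ∈ (extChartAt I' x₀').target)
    (hfy : f ((extChartAt I' x₀').symm y) ∈ (extChartAt I x₀).source)
    (hη : ContDiffAt ℝ ∞ (chartRep I η x₀) (localRep I I' f x₀' x₀ y)) :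
    ContDiffAt ℝ ∞ (chartRep I' (pullForm I I' f η) x₀') y := by
  have hg : ContDiffAt ℝ ∞ (localRep I I' f x₀' x₀) y := contDiffAt_localRep (hf _) hy hfy
  exact (ContDiffAt.alternating_comp (hη.comp y hg)
    (contDiffAt_fderiv_infty hg)).congr_of_eventuallyEq (eventually_chartRep_pullForm hf η hy hfy)

theorem IsSmoothForm.pullForm [FiniteDimensional ℝ E'] {l : ℕ} {f : N' → N}
    (hf : ContMDiff I' I ∞ f) {η : N → E [⋀^Fin l]→L[ℝ] ℝ} (hη : IsSmoothForm I η) :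
    IsSmoothForm I' (pullForm I I' f η) := fun _ _ hy =>
  (contDiffAt_chartRep_pullForm hf hy (mem_extChartAt_source (I := I) _)
    (hη.contDiffAt (mem_extChartAt_target _))).contDiffWithinAt

omit [I.Boundaryless] [IsManifold I ∞ N] in
theorem pullForm_id {l : ℕ} (η : N → E [⋀^Fin l]→L[ℝ] ℝ) :
    pullForm I I (fun y => y) η = η := by
  funext x
  ext v
  simp only [BottShulman.pullForm, tangentMapAt_id]
  rfl

omit [I.Boundaryless] [IsManifold I ∞ N] [I'.Boundaryless] [IsManifold I' ∞ N'] in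
theorem pullForm_comp {E'' : Type*} [NormedAddCommGroup E''] [NormedSpace ℝ E'']
    {H'' : Type*} [TopologicalSpace H''] {I'' : ModelWithCorners ℝ E'' H''}
    {N'' : Type*} [TopologicalSpace N''] [ChartedSpace H'' N''] {l : ℕ}
    {g : N' → N} {f : N'' → N'} (hg : ContMDiff I' I ∞ g) (hf : ContMDiff I'' I' ∞ f)
    (η : N → E [⋀^Fin l]→L[ℝ] ℝ) :
    pullForm I' I'' f (pullForm I I' g η) = pullForm I I'' (fun x => g (f x)) η := by
  funext x
  ext v
  simp only [BottShulman.pullForm, tangentMapAt_comp (I := I) (I' := I') x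
    (mdifferentiableAt_of_contMDiffAt (hg _)) (mdifferentiableAt_of_contMDiffAt (hf _))]
  rfl

/-- A form is smooth if, for each point, its representative in the preferred chart at the point is
smooth there. -/
theorem isSmoothForm_of_contDiffAt [FiniteDimensional ℝ E] {l : ℕ} {η : N → E [⋀^Fin l]→L[ℝ] ℝ}
    (h : ∀ x, ContDiffAt ℝ ∞ (chartRep I η x) (extChartAt I x x)) : IsSmoothForm I η := by
  intro x₀ y hy
  have := contDiffAt_chartRep_pullForm (I := I) (I' := I) contMDiff_id (η := η) hy
    (mem_extChartAt_source (I := I) ((extChartAt I x₀).symm y)) (h _)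
  rw [show pullForm I I id η = η from pullForm_id η] at this
  exact this.contDiffWithinAt

/-- In charts this is the naturality of `extDeriv` under the local representative, followed by the
chain rule. The free choice of `x₀` makes it serve twice: `f = id` gives independence of the chart,
and `x₀ = f x'` gives naturality of `extD`. -/
theorem extD_pullForm_aux {l : ℕ} {f : N' → N} (hf : ContMDiff I' I ∞ f)
    (η : N → E [⋀^Fin l]→L[ℝ] ℝ) {x' : N'} {x₀ : N} (hx : f x' ∈ (extChartAt I x₀).source)
    (hη : ContDiffAt ℝ ∞ (chartRep I η x₀) (extChartAt I x₀ (f x'))) :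
    extD I' (pullForm I I' f η) x' =
      ((extDeriv (chartRep I η x₀) (extChartAt I x₀ (f x'))).compContinuousLinearMap
        (tangentMapAt 𝓘(ℝ, E) I (extChartAt I x₀) (f x'))).compContinuousLinearMap
        (tangentMapAt I I' f x') := by
  have hy := mem_extChartAt_target (I := I') x'
  have hinv : (extChartAt I' x').symm (extChartAt I' x' x') = x' := extChartAt_to_inv x'
  have hfy : f ((extChartAt I' x').symm (extChartAt I' x' x')) ∈ (extChartAt I x₀).source := by
    rwa [hinv]
  have hval : localRep I I' f x' x₀ (extChartAt I' x' x') = extChartAt I x₀ (f x') := by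
    rw [localRep, hinv]
  have hg : ContDiffAt ℝ ∞ (localRep I I' f x' x₀) (extChartAt I' x' x') :=
    contDiffAt_localRep (hf _) hy hfy
  have h1 := Filter.EventuallyEq.extDeriv_eq (eventually_chartRep_pullForm hf η hy hfy)
  have hd : DifferentiableAt ℝ (chartRep I η x₀) (localRep I I' f x' x₀ (extChartAt I' x' x')) := by
    rw [hval]
    exact hη.differentiableAt (by simp)
  have h2 := extDeriv_pullback hd hg minSmoothness_two_le
  rw [extD, h1, h2, hval]
  have h3 := tangentMapAt_comp (I := 𝓘(ℝ, E)) (I' := I) (I'' := I') (g := extChartAt I x₀)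
    (f := f) x' (mdifferentiableAt_of_contMDiffAt (contMDiffAt_extChartAt_of_mem hx))
    (mdifferentiableAt_of_contMDiffAt (hf _))
  have h4 := tangentMapAt_comp (I := 𝓘(ℝ, E)) (I' := 𝓘(ℝ, E')) (I'' := I')
    (g := localRep I I' f x' x₀)
    (f := extChartAt I' x') x'
    (mdifferentiableAt_of_contMDiffAt hg.contMDiffAt)
    (mdifferentiableAt_of_contMDiffAt (contMDiffAt_extChartAt_of_mem (mem_extChartAt_source x')))
  have h5 : (fun z => localRep I I' f x' x₀ (extChartAt I' x' z)) =ᶠ[𝓝 x']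
      fun z => extChartAt I x₀ (f z) := by
    filter_upwards [extChartAt_source_mem_nhds (I := I') x'] with z hz
    rw [localRep, (extChartAt I' x').left_inv hz]
  rw [tangentMapAt_congr h5, h3, tangentMapAt_eq_fderiv] at h4
  ext v
  simp only [ContinuousAlternatingMap.compContinuousLinearMap_apply]
  congr 1
  funext i
  exact (DFunLike.congr_fun h4 (v i)).symm

/-- The exterior derivative may be computed in any preferred chart. -/
theorem extD_eq {l : ℕ} {η : N → E [⋀^Fin l]→L[ℝ] ℝ} (hη : IsSmoothForm I η) {x x₀ : N}
    (hx : x ∈ (extChartAt I x₀).source) :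
    extD I η x = (extDeriv (chartRep I η x₀) (extChartAt I x₀ x)).compContinuousLinearMap
        (tangentMapAt 𝓘(ℝ, E) I (extChartAt I x₀) x) := by
  have h := extD_pullForm_aux (I := I) (I' := I) contMDiff_id η (x' := x) hx
    (hη.contDiffAt ((extChartAt I x₀).map_source hx))
  rw [show pullForm I I id η = η from pullForm_id η] at h
  rw [h]
  ext v
  have : tangentMapAt I I id x = ContinuousLinearMap.id ℝ E := tangentMapAt_id x
  rw [this]
  rfl

/-- The exterior derivative commutes with pullback. -/
theorem extD_pullForm {l : ℕ} {f : N' → N} (hf : ContMDiff I' I ∞ f)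
    {η : N → E [⋀^Fin l]→L[ℝ] ℝ} (hη : IsSmoothForm I η) :
    extD I' (pullForm I I' f η) = pullForm I I' f (extD I η) := by
  funext x
  rw [extD_pullForm_aux hf η (mem_extChartAt_source (f x))
    (hη.contDiffAt (mem_extChartAt_target _))]
  rfl

theorem chartRep_extD {l : ℕ} {η : N → E [⋀^Fin l]→L[ℝ] ℝ} (hη : IsSmoothForm I η) {x₀ : N}
    {y : E} (hy : y ∈ (extChartAt I x₀).target) :
    chartRep I (extD I η) x₀ y = extDeriv (chartRep I η x₀) y := by
  have hs := (extChartAt I x₀).map_target hy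
  have h := tangentMapAt_comp (I := 𝓘(ℝ, E)) (I' := I) (I'' := 𝓘(ℝ, E)) (g := extChartAt I x₀)
    (f := (extChartAt I x₀).symm) y
    (mdifferentiableAt_of_contMDiffAt (contMDiffAt_extChartAt_of_mem hs))
    (mdifferentiableAt_of_contMDiffAt (contMDiffAt_extChartAt_symm' hy))
  have h5 : (fun z => extChartAt I x₀ ((extChartAt I x₀).symm z)) =ᶠ[𝓝 y] fun z => z := by
    filter_upwards [(isOpen_extChartAt_target x₀).mem_nhds hy] with z hz
    exact (extChartAt I x₀).right_inv hz
  rw [tangentMapAt_congr h5, tangentMapAt_id] at h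
  rw [chartRep, extD_eq hη hs, (extChartAt I x₀).right_inv hy]
  ext v
  simp only [ContinuousAlternatingMap.compContinuousLinearMap_apply]
  congr 1
  funext i
  exact (DFunLike.congr_fun h (v i)).symm

theorem contDiffAt_extDeriv {l : ℕ} {σ : E → E [⋀^Fin l]→L[ℝ] ℝ} {y : E}
    (h : ContDiffAt ℝ ∞ σ y) : ContDiffAt ℝ ∞ (extDeriv σ) y := by
  have hc : ContDiff ℝ ∞ ⇑(ContinuousAlternatingMap.alternatizeUncurryFinCLM ℝ E ℝ (n := l)) :=
    ContinuousLinearMap.contDiff _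
  exact hc.contDiffAt.comp y (contDiffAt_fderiv_infty h)

theorem IsSmoothForm.extD {l : ℕ} {η : N → E [⋀^Fin l]→L[ℝ] ℝ} (hη : IsSmoothForm I η) :
    IsSmoothForm I (extD I η) := by
  intro x₀ y hy
  refine ContDiffAt.contDiffWithinAt ?_
  refine (contDiffAt_extDeriv (hη.contDiffAt hy)).congr_of_eventuallyEq ?_
  filter_upwards [(isOpen_extChartAt_target x₀).mem_nhds hy] with z hz
  exact chartRep_extD hη hz

/-- The outer derivative needs the representative of `extD I η` on a neighbourhood, where
`chartRep_extD` identifies it with `extDeriv` in one fixed chart; there the square of `extDeriv`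
vanishes. -/
theorem extD_extD {l : ℕ} {η : N → E [⋀^Fin l]→L[ℝ] ℝ} (hη : IsSmoothForm I η) :
    BottShulman.extD I (BottShulman.extD I η) = 0 := by
  funext x
  have hy := mem_extChartAt_target (I := I) x
  have h : chartRep I (BottShulman.extD I η) x =ᶠ[𝓝 (extChartAt I x x)]
      extDeriv (chartRep I η x) := by
    filter_upwards [(isOpen_extChartAt_target x).mem_nhds hy] with z hz
    exact chartRep_extD hη hz
  rw [BottShulman.extD, h.extDeriv_eq,
    extDeriv_extDeriv_apply (r := ∞) (hη.contDiffAt hy) minSmoothness_two_le]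
  rfl

omit [I.Boundaryless] [IsManifold I ∞ N] in
theorem chartRep_add {l : ℕ} (η ζ : N → E [⋀^Fin l]→L[ℝ] ℝ) (x₀ : N) :
    chartRep I (η + ζ) x₀ = chartRep I η x₀ + chartRep I ζ x₀ := rfl

omit [I.Boundaryless] [IsManifold I ∞ N] in
theorem chartRep_smul {l : ℕ} (c : N → ℝ) (η : N → E [⋀^Fin l]→L[ℝ] ℝ) (x₀ : N) :
    chartRep I (fun x => c x • η x) x₀ =
      fun y => c ((extChartAt I x₀).symm y) • chartRep I η x₀ y := rfl

omit [I.Boundaryless] [IsManifold I ∞ N] in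
theorem isSmoothForm_zero {l : ℕ} : IsSmoothForm I (0 : N → E [⋀^Fin l]→L[ℝ] ℝ) := fun x₀ =>
  (contDiffOn_const (c := (0 : E [⋀^Fin l]→L[ℝ] ℝ))).congr fun y _ => by
    ext v
    rfl

omit [I.Boundaryless] [IsManifold I ∞ N] in
theorem IsSmoothForm.add {l : ℕ} {η ζ : N → E [⋀^Fin l]→L[ℝ] ℝ} (hη : IsSmoothForm I η)
    (hζ : IsSmoothForm I ζ) : IsSmoothForm I (η + ζ) := fun x₀ =>
  (hη x₀).add (hζ x₀)

theorem contDiffAt_function_chart {c : N → ℝ} (hc : ContMDiff I 𝓘(ℝ, ℝ) ∞ c) {x₀ : N} {y : E}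
    (hy : y ∈ (extChartAt I x₀).target) :
    ContDiffAt ℝ ∞ (fun z => c ((extChartAt I x₀).symm z)) y :=
  ((hc _).comp y (contMDiffAt_extChartAt_symm' hy)).contDiffAt

theorem IsSmoothForm.smul {l : ℕ} {c : N → ℝ} (hc : ContMDiff I 𝓘(ℝ, ℝ) ∞ c)
    {η : N → E [⋀^Fin l]→L[ℝ] ℝ} (hη : IsSmoothForm I η) :
    IsSmoothForm I (fun x => c x • η x) := fun _ _ hy =>
  ((contDiffAt_function_chart hc hy).smul (hη.contDiffAt hy)).contDiffWithinAt

omit [I.Boundaryless] [IsManifold I ∞ N] in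
theorem extD_zero {l : ℕ} : BottShulman.extD I (0 : N → E [⋀^Fin l]→L[ℝ] ℝ) = 0 := by
  funext x
  have h : chartRep I (0 : N → E [⋀^Fin l]→L[ℝ] ℝ) x = fun _ => 0 := rfl
  have h' : extDeriv (fun _ : E => (0 : E [⋀^Fin l]→L[ℝ] ℝ)) = fun _ => 0 := by
    funext y
    simp only [extDeriv, fderiv_const_apply]
    exact map_zero (ContinuousAlternatingMap.alternatizeUncurryFinCLM ℝ E ℝ)
  rw [BottShulman.extD, h, h']
  rfl

omit [IsManifold I ∞ N] in
theorem extD_add {l : ℕ} {η ζ : N → E [⋀^Fin l]→L[ℝ] ℝ} (hη : IsSmoothForm I η)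
    (hζ : IsSmoothForm I ζ) :
    BottShulman.extD I (η + ζ) = BottShulman.extD I η + BottShulman.extD I ζ := by
  funext x
  have hd {ξ : N → E [⋀^Fin l]→L[ℝ] ℝ} (h : IsSmoothForm I ξ) :
      DifferentiableAt ℝ (chartRep I ξ x) (extChartAt I x x) :=
    ((h x).contDiffAt ((isOpen_extChartAt_target x).mem_nhds
      (mem_extChartAt_target x))).differentiableAt (by simp)
  rw [BottShulman.extD, chartRep_add, extDeriv_add (hd hη) (hd hζ)]
  rfl

/-- The Leibniz rule for the product of a function and a form. -/
theorem extD_smul {l : ℕ} {c : N → ℝ} (hc : ContMDiff I 𝓘(ℝ, ℝ) ∞ c)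
    {η : N → E [⋀^Fin l]→L[ℝ] ℝ} (hη : IsSmoothForm I η) (x : N) :
    BottShulman.extD I (fun x => c x • η x) x =
      wedge (differential I c x) (η x) + c x • BottShulman.extD I η x := by
  have hy := mem_extChartAt_target (I := I) x
  have hinv : (extChartAt I x).symm (extChartAt I x x) = x := extChartAt_to_inv x
  have hcd := (contDiffAt_function_chart hc hy).differentiableAt (by simp)
  have hηd := (hη.contDiffAt hy).differentiableAt (by simp)
  have h1 : extDeriv (chartRep I (fun x => c x • η x) x) (extChartAt I x x) =
      wedge (fderiv ℝ (fun z => c ((extChartAt I x).symm z)) (extChartAt I x x))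
        (chartRep I η x (extChartAt I x x)) + c x • extDeriv (chartRep I η x)
          (extChartAt I x x) := by
    rw [chartRep_smul, extDeriv, fderiv_fun_smul hcd hηd, extDeriv,
      ContinuousAlternatingMap.alternatizeUncurryFin_add,
      ContinuousAlternatingMap.alternatizeUncurryFin_smul, hinv]
    exact add_comm _ _
  have hid (z : N) (hz : z ∈ (extChartAt I x).source) :=
    (extChartAt I x).left_inv hz
  have hext := mdifferentiableAt_of_contMDiffAt
    (contMDiffAt_extChartAt_of_mem (I := I) (mem_extChartAt_source (I := I) x))
  have h2 := tangentMapAt_comp (I := I) (I' := 𝓘(ℝ, E)) (I'' := I)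
    (g := (extChartAt I x).symm) (f := extChartAt I x) x
    (mdifferentiableAt_of_contMDiffAt (contMDiffAt_extChartAt_symm' hy)) hext
  have h5 : (fun z => (extChartAt I x).symm (extChartAt I x z)) =ᶠ[𝓝 x] fun z => z := by
    filter_upwards [extChartAt_source_mem_nhds (I := I) x] with z hz using hid z hz
  rw [tangentMapAt_congr h5, tangentMapAt_id] at h2
  have h3 := tangentMapAt_comp (I := 𝓘(ℝ, ℝ)) (I' := 𝓘(ℝ, E)) (I'' := I)
    (g := fun z => c ((extChartAt I x).symm z)) (f := extChartAt I x) x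
    hcd.mdifferentiableAt hext
  have h6 : (fun z => c ((extChartAt I x).symm (extChartAt I x z))) =ᶠ[𝓝 x] c := by
    filter_upwards [h5] with z hz using congrArg c hz
  rw [tangentMapAt_congr h6, tangentMapAt_eq_fderiv] at h3
  rw [BottShulman.extD, h1]
  -- Pulling the representative back by the chart recovers `η x`, since the chart followed by its
  -- inverse is the identity near `x`.
  have h7 : (chartRep I η x (extChartAt I x x)).compContinuousLinearMap
      (tangentMapAt 𝓘(ℝ, E) I (extChartAt I x) x) = η x := by
    ext v
    simp only [chartRep, ContinuousAlternatingMap.compContinuousLinearMap_apply, hinv]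
    congr 1
    funext i
    exact (DFunLike.congr_fun h2 (v i)).symm
  have h8 := wedge_comp (fderiv ℝ (fun z => c ((extChartAt I x).symm z)) (extChartAt I x x))
    (chartRep I η x (extChartAt I x x)) (tangentMapAt 𝓘(ℝ, E) I (extChartAt I x) x)
  rw [h7, ← h3] at h8
  exact congrArg (· + c x • BottShulman.extD I η x) h8

end FormCalculus

/-! ### Families of forms concentrated in one degree -/

section Homogeneous

variable {V : Type*} [NormedAddCommGroup V] [NormedSpace ℝ V]
  {V' : Type*} [NormedAddCommGroup V'] [NormedSpace ℝ V']

/-- The family of alternating forms of all degrees with a single component of degree `k`. -/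
def homog {k : ℕ} (η : V [⋀^Fin k]→L[ℝ] ℝ) : ∀ l : ℕ, V [⋀^Fin l]→L[ℝ] ℝ := Pi.single k η

@[simp] theorem homog_self {k : ℕ} (η : V [⋀^Fin k]→L[ℝ] ℝ) : homog η k = η :=
  Pi.single_eq_same (M := fun l => V [⋀^Fin l]→L[ℝ] ℝ) k η

theorem homog_of_ne {k l : ℕ} (η : V [⋀^Fin k]→L[ℝ] ℝ) (h : l ≠ k) : homog η l = 0 :=
  Pi.single_eq_of_ne (M := fun l => V [⋀^Fin l]→L[ℝ] ℝ) h η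

@[simp] theorem homog_zero {k : ℕ} : homog (0 : V [⋀^Fin k]→L[ℝ] ℝ) = 0 :=
  Pi.single_zero k

theorem homog_add {k : ℕ} (η ζ : V [⋀^Fin k]→L[ℝ] ℝ) : homog (η + ζ) = homog η + homog ζ :=
  Pi.single_add (f := fun l => V [⋀^Fin l]→L[ℝ] ℝ) k η ζ

theorem homog_smul {k : ℕ} (c : ℝ) (η : V [⋀^Fin k]→L[ℝ] ℝ) : homog (c • η) = c • homog η :=
  Pi.single_smul (f := fun l => V [⋀^Fin l]→L[ℝ] ℝ) k c η

theorem homog_sum {k : ℕ} {κ : Type*} (s : Finset κ) (η : κ → V [⋀^Fin k]→L[ℝ] ℝ) :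
    homog (∑ i ∈ s, η i) = ∑ i ∈ s, homog (η i) := by
  classical
  induction s using Finset.induction_on with
  | empty => simp
  | insert i s hi ih => rw [Finset.sum_insert hi, Finset.sum_insert hi, homog_add, ih]

theorem homog_comp {k l : ℕ} (η : V [⋀^Fin k]→L[ℝ] ℝ) (A : V' →L[ℝ] V) :
    (homog η l).compContinuousLinearMap A = homog (η.compContinuousLinearMap A) l := by
  by_cases h : l = k
  · subst h; simp
  · rw [homog_of_ne _ h, homog_of_ne _ h]; rfl

/-- Valid for every `l`, since both sides vanish off `l = k`; this and `homog_succ_extD` match the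
degree-raising clauses of the differentials without a case distinction. -/
theorem homog_succ_wedge {k : ℕ} (α : V →L[ℝ] ℝ) (η : V [⋀^Fin k]→L[ℝ] ℝ) (l : ℕ) :
    wedge α (homog η l) = homog (wedge α η) (l + 1) := by
  by_cases h : l = k
  · subst h; simp
  · rw [homog_of_ne _ h, homog_of_ne _ (by omega), wedge_zero]

theorem homog_succ_zero {k : ℕ} (η : V [⋀^Fin (k + 1)]→L[ℝ] ℝ) : homog η 0 = 0 :=
  homog_of_ne _ (by omega)

theorem homog_succ_extD {H : Type*} [TopologicalSpace H] {I : ModelWithCorners ℝ V H}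
    {N : Type*} [TopologicalSpace N] [ChartedSpace H N] {k : ℕ} (η : N → V [⋀^Fin k]→L[ℝ] ℝ)
    (l : ℕ) (x : N) : extD I (fun y => homog (η y) l) x = homog (extD I η x) (l + 1) := by
  by_cases h : l = k
  · subst h; simp
  · rw [homog_of_ne _ (by omega)]
    have : (fun y => homog (η y) l) = 0 := funext fun y => homog_of_ne _ h
    rw [this, extD_zero]
    rfl

end Homogeneous

/-! ### Elements of the fibre algebra linear in the generators -/

section Linear

variable {ι : Type*} [Fintype ι] [LinearOrder ι]
  {V : Type*} [NormedAddCommGroup V] [NormedSpace ℝ V]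
  {V' : Type*} [NormedAddCommGroup V'] [NormedSpace ℝ V']

theorem ofDegree_apply {k : ℕ} (η : V [⋀^Fin k]→L[ℝ] ℝ) (J : Finset ι) (K : ι → ℕ) :
    (ofDegree η : Fib ι V) J K = if J = ∅ ∧ K = 0 then homog η else 0 := by
  funext l
  simp only [ofDegree, ofForm, homog]
  split_ifs <;> rfl

theorem mulE_ofDegree_apply {k : ℕ} (η : V [⋀^Fin k]→L[ℝ] ℝ) (i : ι) (J : Finset ι)
    (K : ι → ℕ) :
    mulE i (ofDegree η : Fib ι V) J K = if J = {i} ∧ K = 0 then homog η else 0 := by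
  funext l
  simp only [mulE, ofDegree_apply]
  by_cases h : J = {i}
  · subst h
    by_cases hK : K = 0 <;> simp [hK, Finset.filter_singleton]
  · have : i ∈ J → J.erase i ≠ ∅ := fun hi he => h (by
      rw [← Finset.insert_erase hi, he]; rfl)
    by_cases hi : i ∈ J
    · simp [h, hi, this hi]
    · simp [h, hi]

/-- Subtraction is truncated: without `0 < K i` the exponent `K = 0` would satisfy the left side but
not the right. -/
theorem sub_single_eq_zero_iff {K : ι → ℕ} {i : ι} (hi : 0 < K i) :
    K - Pi.single i 1 = 0 ↔ K = Pi.single i 1 := by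
  constructor
  · intro h
    funext j
    have hj := congrFun h j
    by_cases hji : j = i
    · subst hji
      simp at hj ⊢
      omega
    · simpa [hji] using hj
  · rintro rfl
    simp

theorem mulDE_ofDegree_apply {k : ℕ} (η : V [⋀^Fin k]→L[ℝ] ℝ) (i : ι) (J : Finset ι)
    (K : ι → ℕ) :
    mulDE i (ofDegree η : Fib ι V) J K = if J = ∅ ∧ K = Pi.single i 1 then homog η else 0 := by
  funext l
  simp only [mulDE, ofDegree_apply]
  by_cases hi : 0 < K i
  · simp only [hi, if_true, sub_single_eq_zero_iff hi]
    by_cases hJ : J = ∅ <;> by_cases hK : K = Pi.single i 1 <;> simp [hJ, hK]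
  · have : K ≠ Pi.single i 1 := by
      rintro rfl
      simp at hi
    simp [hi, this]

/-- The element `∑ i, (E_i * η i + dE_i * ζ i)` of the fibre algebra. -/
def lin (η : ι → V [⋀^Fin 2]→L[ℝ] ℝ) (ζ : ι → V [⋀^Fin 1]→L[ℝ] ℝ) : Fib ι V :=
  ∑ i, (mulE i (ofDegree (η i)) + mulDE i (ofDegree (ζ i)))

variable {η η' : ι → V [⋀^Fin 2]→L[ℝ] ℝ} {ζ ζ' : ι → V [⋀^Fin 1]→L[ℝ] ℝ}

theorem lin_apply (J : Finset ι) (K : ι → ℕ) :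
    lin η ζ J K = ∑ i, ((if J = {i} ∧ K = 0 then homog (η i) else 0) +
      if J = ∅ ∧ K = Pi.single i 1 then homog (ζ i) else 0) := by
  simp only [lin, Finset.sum_apply, Pi.add_apply, mulE_ofDegree_apply, mulDE_ofDegree_apply]

theorem single_one_inj {i j : ι} : (Pi.single i 1 : ι → ℕ) = Pi.single j 1 ↔ i = j := by
  constructor
  · intro h
    by_contra hne
    have := congrFun h i
    simp [hne] at this
  · rintro rfl
    rfl

theorem lin_singleton (i : ι) : lin η ζ {i} 0 = homog (η i) := by
  simp [lin_apply, Finset.singleton_inj]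

theorem lin_empty_single (i : ι) : lin η ζ ∅ (Pi.single i 1) = homog (ζ i) := by
  have (j : ι) : (∅ : Finset ι) ≠ {j} := (Finset.singleton_ne_empty j).symm
  simp [lin_apply, single_one_inj, this]

theorem lin_eq_zero {J : Finset ι} {K : ι → ℕ} (h1 : ∀ i, J = {i} → K ≠ 0)
    (h2 : ∀ i, J = ∅ → K ≠ Pi.single i 1) : lin η ζ J K = 0 := by
  rw [lin_apply]
  refine Finset.sum_eq_zero fun i _ => ?_
  rw [if_neg (fun h => h1 i h.1 h.2), if_neg (fun h => h2 i h.1 h.2), add_zero]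

/-- Case distinction on the components of an element which is linear in the generators. -/
theorem linear_cases (J : Finset ι) (K : ι → ℕ) :
    (∃ i, J = {i} ∧ K = 0) ∨ (∃ i, J = ∅ ∧ K = Pi.single i 1) ∨
      ((∀ i, J = {i} → K ≠ 0) ∧ ∀ i, J = ∅ → K ≠ Pi.single i 1) := by
  by_cases h1 : ∃ i, J = {i} ∧ K = 0
  · exact Or.inl h1
  by_cases h2 : ∃ i, J = ∅ ∧ K = Pi.single i 1
  · exact Or.inr (Or.inl h2)
  · push Not at h1 h2
    exact Or.inr (Or.inr ⟨h1, h2⟩)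

theorem lin_add : lin η ζ + lin η' ζ' = lin (η + η') (ζ + ζ') := by
  funext J K
  simp only [Pi.add_apply, lin_apply, ← Finset.sum_add_distrib, homog_add]
  refine Finset.sum_congr rfl fun i _ => ?_
  split_ifs <;> simp [add_add_add_comm, add_comm]

theorem lin_smul (c : ℝ) : c • lin η ζ = lin (c • η) (c • ζ) := by
  funext J K
  simp only [Pi.smul_apply, lin_apply, Finset.smul_sum, homog_smul]
  refine Finset.sum_congr rfl fun i _ => ?_
  split_ifs <;> simp

theorem lin_zero : lin (0 : ι → V [⋀^Fin 2]→L[ℝ] ℝ) 0 = 0 := by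
  funext J K
  simp only [lin_apply, Pi.zero_apply, homog_zero, ite_self, add_zero, Finset.sum_const_zero]

theorem lin_sum {κ : Type*} (s : Finset κ) (η : κ → ι → V [⋀^Fin 2]→L[ℝ] ℝ)
    (ζ : κ → ι → V [⋀^Fin 1]→L[ℝ] ℝ) :
    ∑ k ∈ s, lin (η k) (ζ k) = lin (∑ k ∈ s, η k) (∑ k ∈ s, ζ k) := by
  classical
  induction s using Finset.induction_on with
  | empty => simp [lin_zero]
  | insert i s hi ih =>
    rw [Finset.sum_insert hi, Finset.sum_insert hi, Finset.sum_insert hi, ih, lin_add]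

theorem insert_eq_singleton {J : Finset ι} {i j : ι} (hi : i ∉ J) (h : insert i J = {j}) :
    J = ∅ ∧ i = j := by
  have hij : i = j := Finset.mem_singleton.1 (h ▸ Finset.mem_insert_self i J)
  subst hij
  refine ⟨Finset.eq_empty_of_forall_notMem fun a ha => ?_, rfl⟩
  have : a = i := Finset.mem_singleton.1 (h ▸ Finset.mem_insert_of_mem ha)
  exact hi (this ▸ ha)

/-- The first-order terms `∑ i, E_i * θ i`, componentwise. -/
theorem sum_mulE_apply {k : ℕ} (θ : ι → V [⋀^Fin k]→L[ℝ] ℝ) (J : Finset ι) (K : ι → ℕ) :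
    (∑ i, mulE i (ofDegree (θ i)) : Fib ι V) J K =
      ∑ i, if J = {i} ∧ K = 0 then homog (θ i) else 0 := by
  simp only [Finset.sum_apply, mulE_ofDegree_apply]

theorem sum_mulE_singleton {k : ℕ} (θ : ι → V [⋀^Fin k]→L[ℝ] ℝ) (i : ι) :
    (∑ i, mulE i (ofDegree (θ i)) : Fib ι V) {i} 0 = homog (θ i) := by
  simp [sum_mulE_apply, Finset.singleton_inj]

theorem sum_mulE_eq_zero {k : ℕ} (θ : ι → V [⋀^Fin k]→L[ℝ] ℝ) {J : Finset ι} {K : ι → ℕ}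
    (h : ∀ i, J = {i} → K ≠ 0) : (∑ i, mulE i (ofDegree (θ i)) : Fib ι V) J K = 0 := by
  rw [sum_mulE_apply]
  exact Finset.sum_eq_zero fun i _ => if_neg fun h' => h i h'.1 h'.2

end Linear

/-! ### The differentials on pure and on linear elements -/

section Differentials

variable {ι : Type*} [Fintype ι] [LinearOrder ι]
  {E : Type*} [NormedAddCommGroup E] [NormedSpace ℝ E]
  {H : Type*} [TopologicalSpace H] {I : ModelWithCorners ℝ E H}
  {N : Type*} [TopologicalSpace N] [ChartedSpace H N]

theorem deRham_zero : deRham I (0 : N → Fib ι E) = 0 := by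
  funext x J K l
  cases l with
  | zero => simp [deRham]
  | succ l =>
    have h : (fun _ : N => (0 : E [⋀^Fin l]→L[ℝ] ℝ)) = 0 := rfl
    simp [deRham, h, extD_zero]

theorem internal_zero (μ : ι → N → ℝ) : internal I μ (0 : N → Fib ι E) = 0 := by
  funext x J K l
  cases l <;> simp [internal]

theorem deRham_ofDegree {k : ℕ} (η : N → E [⋀^Fin k]→L[ℝ] ℝ) (x : N) :
    deRham I (fun y => (ofDegree (η y) : Fib ι E)) x = ofDegree (extD I η x) := by
  funext J K l
  have h1 : (∑ i, if i ∉ J ∧ 0 < K i then (-1 : ℝ) ^ (J.filter (i < ·)).card •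
      (ofDegree (η x) : Fib ι E) (insert i J) (K - Pi.single i 1) l else 0) = 0 :=
    Finset.sum_eq_zero fun i _ => by simp [ofDegree_apply]
  simp only [deRham]
  rw [h1, zero_add]
  by_cases h : J = ∅ ∧ K = 0
  · obtain ⟨rfl, rfl⟩ := h
    cases l with
    | zero => simp [ofDegree_apply, homog_succ_zero]
    | succ l => simp [ofDegree_apply, homog_succ_extD]
  · cases l with
    | zero => simp [ofDegree_apply, h]
    | succ l =>
      have h0 : (fun _ : N => (0 : E [⋀^Fin l]→L[ℝ] ℝ)) = 0 := rfl
      simp [ofDegree_apply, h, h0, extD_zero]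

theorem internal_ofDegree (μ : ι → N → ℝ) {k : ℕ} (η : N → E [⋀^Fin k]→L[ℝ] ℝ) :
    internal I μ (fun y => (ofDegree (η y) : Fib ι E)) = 0 := by
  funext x J K l
  have h1 (i : ι) : K + Pi.single i 1 ≠ 0 := fun h => by simpa using congrFun h i
  cases l <;> simp [internal, ofDegree_apply, h1]

theorem not_pos_single {i j : ι} (h : i ≠ j) : ¬0 < (Pi.single j 1 : ι → ℕ) i := by
  simp [h]

/-- The Leibniz rule `d(E_i θ_i) = E_i dθ_i + dE_i θ_i`; there is no sign because `E_i` has form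
degree 0. -/
theorem deRham_sum_mulE (θ : ι → N → E [⋀^Fin 1]→L[ℝ] ℝ) (x : N) :
    deRham I (fun y => (∑ i, mulE i (ofDegree (θ i y)) : Fib ι E)) x =
      lin (fun i => extD I (θ i) x) fun i => θ i x := by
  funext J K l
  have h0 (l : ℕ) : (fun _ : N => (0 : E [⋀^Fin l]→L[ℝ] ℝ)) = 0 := rfl
  simp only [deRham]
  rcases linear_cases J K with ⟨j, rfl, rfl⟩ | ⟨j, rfl, rfl⟩ | ⟨h1, h2⟩
  · rw [lin_singleton]
    cases l with
    | zero => simp [homog_succ_zero]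
    | succ l => simp [sum_mulE_singleton, homog_succ_extD]
  · rw [lin_empty_single, Finset.sum_eq_single j]
    · have : (insert j ∅ : Finset ι) = {j} := rfl
      have h3 (y : N) := sum_mulE_eq_zero (fun i => θ i y) (J := ∅) (K := Pi.single j 1)
        fun i h => absurd h (Finset.singleton_ne_empty i).symm
      simp only [h3, this]
      cases l with
      | zero => simp [sum_mulE_singleton]
      | succ l => simp [sum_mulE_singleton, h0, extD_zero]
    · intro i _ hij
      rw [if_neg (fun h => not_pos_single hij h.2)]
    · simp
  · have h3 (y : N) := sum_mulE_eq_zero (fun i => θ i y) h1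
    rw [lin_eq_zero h1 h2, Finset.sum_eq_zero]
    · simp only [h3]
      cases l <;> simp [h0, extD_zero]
    · intro i _
      split_ifs with hi
      · rw [sum_mulE_eq_zero]
        · simp
        · intro j hj hK
          exact h2 i (insert_eq_singleton hi.1 hj).1 ((sub_single_eq_zero_iff hi.2).1 hK)
      · rfl

theorem deRham_lin_extD {ζ : ι → N → E [⋀^Fin 1]→L[ℝ] ℝ}
    (hζ : ∀ i, extD I (extD I (ζ i)) = 0) (x : N) :
    deRham I (fun y => (lin (fun i => extD I (ζ i) y) (fun i => ζ i y) : Fib ι E)) x = 0 := by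
  funext J K l
  have h0 (l : ℕ) : (fun _ : N => (0 : E [⋀^Fin l]→L[ℝ] ℝ)) = 0 := rfl
  simp only [deRham]
  rcases linear_cases J K with ⟨j, rfl, rfl⟩ | ⟨j, rfl, rfl⟩ | ⟨h1, h2⟩
  · cases l with
    | zero => simp
    | succ l => simp [lin_singleton, homog_succ_extD, hζ]
  · rw [Finset.sum_eq_single j]
    · have : (insert j ∅ : Finset ι) = {j} := rfl
      -- This exponent gives `d(dE_j ζ_j) = -dE_j dζ_j`, which cancels the term `dE_j dζ_j` coming
      -- from `E_j dζ_j`.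
      have h3 : ∑ i, (Pi.single j 1 : ι → ℕ) i = 1 := by simp
      simp only [this, lin_empty_single, h3]
      cases l with
      | zero => simp [lin_singleton, homog_succ_zero]
      | succ l =>
        simp only [homog_succ_extD, pow_one]
        ext v
        simp [lin_singleton]
    · intro i _ hij
      rw [if_neg (fun h => not_pos_single hij h.2)]
    · simp
  · rw [Finset.sum_eq_zero]
    · simp only [lin_eq_zero h1 h2]
      cases l <;> simp [h0, extD_zero]
    · intro i _
      split_ifs with hi
      · rw [lin_eq_zero]
        · simp
        · intro j hj hK
          exact h2 i (insert_eq_singleton hi.1 hj).1 ((sub_single_eq_zero_iff hi.2).1 hK)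
        · intro j hj
          simp at hj
      · rfl

/-- The contraction replaces `E_i` by `μ i` and `dE_i` by its differential, so it removes the only
generator of each term. At `K = 0` the factor `K i + 1` is 1 and all signs are positive. -/
theorem internal_lin (μ : ι → N → ℝ) (η : ι → N → E [⋀^Fin 2]→L[ℝ] ℝ)
    (ζ : ι → N → E [⋀^Fin 1]→L[ℝ] ℝ) (x : N) :
    internal I μ (fun y => (lin (fun i => η i y) (fun i => ζ i y) : Fib ι E)) x =
      ofDegree (∑ i, (μ i x • η i x + wedge (differential I (μ i) x) (ζ i x))) := by
  funext J K l
  simp only [internal]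
  by_cases h : J = ∅ ∧ K = 0
  · obtain ⟨rfl, rfl⟩ := h
    have : ∀ i : ι, (insert i ∅ : Finset ι) = {i} := fun _ => rfl
    cases l with
    | zero => simp [this, lin_singleton, ofDegree_apply, homog_succ_zero]
    | succ l =>
      simp [this, lin_singleton, lin_empty_single, ofDegree_apply, homog_sum, homog_add,
        homog_smul, homog_succ_wedge, Finset.sum_add_distrib]
  · rw [ofDegree_apply, if_neg h, Finset.sum_eq_zero]
    · have h2 (i : ι) : lin (fun i => η i x) (fun i => ζ i x) J (K + Pi.single i 1) = 0 := by
        refine lin_eq_zero (fun j _ hK => ?_) fun j hJ hK => h ⟨hJ, ?_⟩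
        · simpa using congrFun hK i
        · funext a
          have hi := congrFun hK i
          have ha := congrFun hK a
          by_cases hij : i = j
          · subst hij
            simpa using ha
          · simp [hij] at hi
      cases l <;> simp [h2]
    · intro i _
      split_ifs with hi
      · rfl
      · rw [lin_eq_zero]
        · simp
        · intro j hj hK
          exact h ⟨(insert_eq_singleton hi hj).1, hK⟩
        · intro j hj
          simp at hj

end Differentials

/-! ### The homomorphism of fibre algebras on pure and on linear elements -/

section Pullback

variable {ι : Type*} [Fintype ι] [LinearOrder ι]
  {V : Type*} [NormedAddCommGroup V] [NormedSpace ℝ V]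
  {V' : Type*} [NormedAddCommGroup V'] [NormedSpace ℝ V']

theorem ofForm_homog {k : ℕ} (η : V [⋀^Fin k]→L[ℝ] ℝ) :
    (ofForm (homog η) : Fib ι V) = ofDegree η := rfl

theorem ofForm_zero : (ofForm (0 : ∀ l : ℕ, V [⋀^Fin l]→L[ℝ] ℝ) : Fib ι V) = 0 := by
  funext J K l
  simp [ofForm]

theorem mulE_zero (i : ι) : mulE i (0 : Fib ι V) = 0 := by
  funext J K l
  simp [mulE]

theorem mulDE_zero (i : ι) : mulDE i (0 : Fib ι V) = 0 := by
  funext J K l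
  simp [mulDE]

theorem mulCovector_zero (α : V →L[ℝ] ℝ) : mulCovector α (0 : Fib ι V) = 0 := by
  funext J K l
  cases l <;> simp [mulCovector]

theorem mulPullE_zero (c : ι → ι → ℝ) (i : ι) : mulPullE c i (0 : Fib ι V) = 0 := by
  simp [mulPullE, mulE_zero]

theorem mulPullDE_zero (c : ι → ι → ℝ) (dc : ι → ι → V →L[ℝ] ℝ) (i : ι) :
    mulPullDE c dc i (0 : Fib ι V) = 0 := by
  simp [mulPullDE, mulE_zero, mulDE_zero, mulCovector_zero]

/-- The image of the monomial `E_J * dE_K * η` under the homomorphism of fibre algebras. -/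
def monomialPull (c : ι → ι → ℝ) (dc : ι → ι → V' →L[ℝ] ℝ) (J : Finset ι) (K : ι → ℕ)
    (η : ∀ l : ℕ, V' [⋀^Fin l]→L[ℝ] ℝ) : Fib ι V' :=
  (J.sort (· ≤ ·)).foldr (mulPullE c)
    ((Finset.univ.sort (· ≤ ·)).foldr (fun i => (mulPullDE c dc i)^[K i]) (ofForm η))

theorem foldr_fixed {α β : Type*} (f : α → β → β) (b : β) (l : List α) (h : ∀ a, f a b = b) :
    l.foldr f b = b := by
  induction l with
  | nil => rfl
  | cons a l ih => rw [List.foldr_cons, ih, h]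

theorem monomialPull_zero (c : ι → ι → ℝ) (dc : ι → ι → V' →L[ℝ] ℝ) (J : Finset ι)
    (K : ι → ℕ) : monomialPull c dc J K 0 = 0 := by
  rw [monomialPull, ofForm_zero, foldr_fixed _ _ (Finset.univ.sort (· ≤ ·)), foldr_fixed]
  · exact fun a => mulPullE_zero c a
  · exact fun a => Function.iterate_fixed (mulPullDE_zero c dc a) _

/-- With exponent `Pi.single i 1` the ordered product of powers has one nontrivial factor; `Nodup`
ensures that it is applied once. -/
theorem foldr_iterate_single {β : Type*} (f : ι → β → β) (b : β) (i : ι) (l : List ι)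
    (hl : l.Nodup) :
    l.foldr (fun j => (f j)^[(Pi.single i 1 : ι → ℕ) j]) b = if i ∈ l then f i b else b := by
  induction l with
  | nil => simp
  | cons a l ih =>
    rw [List.nodup_cons] at hl
    rw [List.foldr_cons, ih hl.2]
    by_cases h : a = i
    · subst h
      simp [hl.1]
    · simp [h, Ne.symm h]

theorem monomialPull_empty (c : ι → ι → ℝ) (dc : ι → ι → V' →L[ℝ] ℝ)
    (η : ∀ l : ℕ, V' [⋀^Fin l]→L[ℝ] ℝ) : monomialPull c dc ∅ 0 η = ofForm η := by
  rw [monomialPull, foldr_fixed _ _ (Finset.univ.sort (· ≤ ·)) (fun _ => rfl), Finset.sort_empty]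
  rfl

theorem monomialPull_singleton (c : ι → ι → ℝ) (dc : ι → ι → V' →L[ℝ] ℝ) (i : ι)
    (η : V' [⋀^Fin 2]→L[ℝ] ℝ) :
    monomialPull c dc {i} 0 (homog η) = lin (fun a => c a i • η) 0 := by
  rw [monomialPull, foldr_fixed _ _ (Finset.univ.sort (· ≤ ·)) (fun _ => rfl),
    Finset.sort_singleton, List.foldr_cons, List.foldr_nil, mulPullE, ofForm_homog]
  funext J K
  simp only [Finset.sum_apply, Pi.smul_apply, mulE_ofDegree_apply, lin_apply, homog_smul,
    Pi.zero_apply, homog_zero, ite_self, add_zero, smul_ite, smul_zero]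

theorem mulCovector_mulE_ofDegree (α : V →L[ℝ] ℝ) (i : ι) {k : ℕ} (η : V [⋀^Fin k]→L[ℝ] ℝ) :
    mulCovector α (mulE i (ofDegree η : Fib ι V)) = mulE i (ofDegree (wedge α η)) := by
  funext J K l
  by_cases h : J = {i} ∧ K = 0
  · obtain ⟨rfl, rfl⟩ := h
    cases l with
    | zero => simp [mulCovector, mulE_ofDegree_apply, homog_succ_zero]
    | succ l => simp [mulCovector, mulE_ofDegree_apply, homog_succ_wedge]
  · cases l <;> simp [mulCovector, mulE_ofDegree_apply, h]

theorem monomialPull_empty_single (c : ι → ι → ℝ) (dc : ι → ι → V' →L[ℝ] ℝ) (i : ι)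
    (ζ : V' [⋀^Fin 1]→L[ℝ] ℝ) :
    monomialPull c dc ∅ (Pi.single i 1) (homog ζ) =
      lin (fun a => wedge (dc a i) ζ) fun a => c a i • ζ := by
  rw [monomialPull, foldr_iterate_single _ _ _ _ (Finset.sort_nodup _ _),
    if_pos ((Finset.mem_sort _).2 (Finset.mem_univ i)), Finset.sort_empty, List.foldr_nil,
    ofForm_homog, mulPullDE]
  simp only [mulCovector_mulE_ofDegree]
  funext J K
  simp only [Finset.sum_apply, Pi.smul_apply, Pi.add_apply, mulE_ofDegree_apply,
    mulDE_ofDegree_apply, lin_apply, homog_smul, smul_ite, smul_zero]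

theorem fibPull_apply (A : V' →L[ℝ] V) (c : ι → ι → ℝ) (dc : ι → ι → V' →L[ℝ] ℝ)
    (F : Fib ι V) (J' : Finset ι) (K' : ι → ℕ) (l' : ℕ) :
    fibPull A c dc F J' K' l' = ∑ J : Finset ι, ∑ᶠ K : ι → ℕ,
      monomialPull c dc J K (fun l => (F J K l).compContinuousLinearMap A) J' K' l' := rfl

theorem monomialPull_of_eq_zero (A : V' →L[ℝ] V) (c : ι → ι → ℝ) (dc : ι → ι → V' →L[ℝ] ℝ)
    {F : Fib ι V} {J : Finset ι} {K : ι → ℕ} (h : F J K = 0) (J' : Finset ι) (K' : ι → ℕ)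
    (l' : ℕ) :
    monomialPull c dc J K (fun l => (F J K l).compContinuousLinearMap A) J' K' l' = 0 := by
  have : (fun l => (F J K l).compContinuousLinearMap A) = 0 := by
    funext l
    rw [h]
    rfl
  rw [this, monomialPull_zero]
  rfl

theorem fibPull_zero (A : V' →L[ℝ] V) (c : ι → ι → ℝ) (dc : ι → ι → V' →L[ℝ] ℝ) :
    fibPull A c dc (0 : Fib ι V) = 0 := by
  funext J' K' l'
  rw [fibPull_apply]
  refine Finset.sum_eq_zero fun J _ => finsum_eq_zero_of_forall_eq_zero fun K => ?_
  exact monomialPull_of_eq_zero A c dc rfl J' K' l'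

theorem fibPull_ofDegree (A : V' →L[ℝ] V) (c : ι → ι → ℝ) (dc : ι → ι → V' →L[ℝ] ℝ) {k : ℕ}
    (η : V [⋀^Fin k]→L[ℝ] ℝ) :
    fibPull A c dc (ofDegree η : Fib ι V) = ofDegree (η.compContinuousLinearMap A) := by
  funext J' K' l'
  have h {J : Finset ι} {K : ι → ℕ} (hJK : ¬(J = ∅ ∧ K = 0)) :=
    monomialPull_of_eq_zero A c dc (F := ofDegree η) (J := J) (K := K)
      (by rw [ofDegree_apply, if_neg hJK]) J' K' l'
  rw [fibPull_apply, Finset.sum_eq_single ∅, finsum_eq_single _ 0]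
  · have : (fun l => ((ofDegree η : Fib ι V) ∅ 0 l).compContinuousLinearMap A) =
        homog (η.compContinuousLinearMap A) := by
      funext l
      rw [ofDegree_apply, if_pos ⟨rfl, rfl⟩, homog_comp]
    rw [this, monomialPull_empty, ofForm_homog]
  · exact fun K hK => h fun h' => hK h'.2
  · exact fun J _ hJ => finsum_eq_zero_of_forall_eq_zero fun K => h fun h' => hJ h'.1
  · simp

/-- Only the monomials `E_i` and `dE_i` contribute, so the sum over all `(J, K)` collapses. The
image of `dE_i` also contains `E_a` with coefficient `dc a i`, whence the wedge terms in the first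
argument of `lin`. -/
theorem fibPull_lin (A : V' →L[ℝ] V) (c : ι → ι → ℝ) (dc : ι → ι → V' →L[ℝ] ℝ)
    (η : ι → V [⋀^Fin 2]→L[ℝ] ℝ) (ζ : ι → V [⋀^Fin 1]→L[ℝ] ℝ) :
    fibPull A c dc (lin η ζ) =
      lin (fun a => ∑ i, (c a i • (η i).compContinuousLinearMap A +
          wedge (dc a i) ((ζ i).compContinuousLinearMap A)))
        fun a => ∑ i, c a i • (ζ i).compContinuousLinearMap A := by
  have key : fibPull A c dc (lin η ζ) = ∑ i,
      (lin (fun a => c a i • (η i).compContinuousLinearMap A) 0 +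
        lin (fun a => wedge (dc a i) ((ζ i).compContinuousLinearMap A))
          fun a => c a i • (ζ i).compContinuousLinearMap A) := by
    funext J' K' l'
    have h {J : Finset ι} {K : ι → ℕ} (h1 : ∀ i, J = {i} → K ≠ 0)
        (h2 : ∀ i, J = ∅ → K ≠ Pi.single i 1) :=
      monomialPull_of_eq_zero A c dc (F := lin η ζ) (lin_eq_zero h1 h2) J' K' l'
    set T : Finset ι → (ι → ℕ) → V' [⋀^Fin l']→L[ℝ] ℝ := fun J K =>
      monomialPull c dc J K (fun l => (lin η ζ J K l).compContinuousLinearMap A) J' K' l' with hT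
    have hS (i : ι) : T {i} 0 =
        lin (fun a => c a i • (η i).compContinuousLinearMap A) 0 J' K' l' := by
      have : (fun l => (lin η ζ {i} 0 l).compContinuousLinearMap A) =
          homog ((η i).compContinuousLinearMap A) := by
        funext l
        rw [lin_singleton, homog_comp]
      simp only [hT]
      rw [this, monomialPull_singleton]
    have hD (i : ι) : T ∅ (Pi.single i 1) =
        lin (fun a => wedge (dc a i) ((ζ i).compContinuousLinearMap A))
          (fun a => c a i • (ζ i).compContinuousLinearMap A) J' K' l' := by
      have : (fun l => (lin η ζ ∅ (Pi.single i 1) l).compContinuousLinearMap A) =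
          homog ((ζ i).compContinuousLinearMap A) := by
        funext l
        rw [lin_empty_single, homog_comp]
      simp only [hT]
      rw [this, monomialPull_empty_single]
    have hne (i : ι) : (∅ : Finset ι) ≠ {i} := (Finset.singleton_ne_empty i).symm
    -- For `J = ∅` the support in `K` lies in the finite set of exponents `Pi.single i 1`.
    have hempty : ∑ᶠ K, T ∅ K = ∑ i, T ∅ (Pi.single i 1) := by
      rw [finsum_eq_sum_of_support_subset (s := Finset.univ.image fun i : ι =>
        (Pi.single i 1 : ι → ℕ)), Finset.sum_image fun i _ j _ hij => single_one_inj.1 hij]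
      intro K hK
      by_contra hK'
      refine hK (h (fun i hi => absurd hi (hne i)) fun i _ hKi => hK' ?_)
      simp [hKi]
    have hsingle (i : ι) : ∑ᶠ K, T {i} K = T {i} 0 := by
      refine finsum_eq_single _ 0 fun K hK => ?_
      exact h (fun _ _ => hK) fun j hj => absurd hj (Finset.singleton_ne_empty i)
    have hother (J : Finset ι) (h1 : J ≠ ∅) (h2 : ∀ i, J ≠ {i}) : ∑ᶠ K, T J K = 0 :=
      finsum_eq_zero_of_forall_eq_zero fun K =>
        h (fun i hi => absurd hi (h2 i)) fun _ hi => absurd hi h1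
    have hsum : ∑ J, ∑ᶠ K, T J K = ∑ J ∈ insert ∅ (Finset.univ.image fun i : ι => ({i} : Finset ι)),
        ∑ᶠ K, T J K := by
      refine (Finset.sum_subset (Finset.subset_univ _) fun J _ hJ => ?_).symm
      simp only [Finset.mem_insert, Finset.mem_image, Finset.mem_univ, true_and, not_or,
        not_exists] at hJ
      exact hother J hJ.1 fun i hi => hJ.2 i hi.symm
    rw [fibPull_apply]
    change ∑ J, ∑ᶠ K, T J K = _
    rw [hsum, Finset.sum_insert (by simp), hempty,
      Finset.sum_image fun i _ j _ hij => Finset.singleton_injective hij]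
    simp only [hsingle, hS, hD, Finset.sum_apply, Pi.add_apply]
    rw [← Finset.sum_add_distrib]
    exact Finset.sum_congr rfl fun i _ => add_comm _ _
  rw [key]
  simp only [lin_add, lin_sum]
  congr 1 <;> funext a <;> simp

end Pullback

/-! ### Finite sums of forms -/

section FormSums

variable {E : Type*} [NormedAddCommGroup E] [NormedSpace ℝ E]
  {H : Type*} [TopologicalSpace H] {I : ModelWithCorners ℝ E H} [I.Boundaryless]
  {N : Type*} [TopologicalSpace N] [ChartedSpace H N]

theorem IsSmoothForm.sum {κ : Type*} (s : Finset κ) {l : ℕ} {η : κ → N → E [⋀^Fin l]→L[ℝ] ℝ}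
    (h : ∀ i ∈ s, IsSmoothForm I (η i)) : IsSmoothForm I (∑ i ∈ s, η i) := by
  classical
  induction s using Finset.induction_on with
  | empty => exact isSmoothForm_zero
  | insert i s hi ih =>
    rw [Finset.sum_insert hi]
    exact (h i (Finset.mem_insert_self i s)).add
      (ih fun j hj => h j (Finset.mem_insert_of_mem hj))

theorem extD_sum {κ : Type*} (s : Finset κ) {l : ℕ} {η : κ → N → E [⋀^Fin l]→L[ℝ] ℝ}
    (h : ∀ i ∈ s, IsSmoothForm I (η i)) :
    extD I (∑ i ∈ s, η i) = ∑ i ∈ s, extD I (η i) := by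
  classical
  induction s using Finset.induction_on with
  | empty => exact extD_zero
  | insert i s hi ih =>
    have hs : ∀ j ∈ s, IsSmoothForm I (η j) := fun j hj => h j (Finset.mem_insert_of_mem hj)
    rw [Finset.sum_insert hi, Finset.sum_insert hi,
      extD_add (h i (Finset.mem_insert_self i s)) (IsSmoothForm.sum s hs), ih hs]

end FormSums

/-! ### Derivatives of functions of two variables -/

section ProductRule

variable {EA : Type*} [NormedAddCommGroup EA] [NormedSpace ℝ EA]
  {HA : Type*} [TopologicalSpace HA] {IA : ModelWithCorners ℝ EA HA}
  {A : Type*} [TopologicalSpace A] [ChartedSpace HA A]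
  {EB : Type*} [NormedAddCommGroup EB] [NormedSpace ℝ EB]
  {HB : Type*} [TopologicalSpace HB] {IB : ModelWithCorners ℝ EB HB}
  {B : Type*} [TopologicalSpace B] [ChartedSpace HB B]
  {E : Type*} [NormedAddCommGroup E] [NormedSpace ℝ E]
  {H : Type*} [TopologicalSpace H] {I : ModelWithCorners ℝ E H}
  {N : Type*} [TopologicalSpace N] [ChartedSpace H N]
  {E' : Type*} [NormedAddCommGroup E'] [NormedSpace ℝ E']
  {H' : Type*} [TopologicalSpace H'] {I' : ModelWithCorners ℝ E' H'}
  {N' : Type*} [TopologicalSpace N'] [ChartedSpace H' N']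

/-- The derivative of a function of two variables along a pair of maps. -/
theorem tangentMapAt_prod {F : A × B → N} {p : N' → A} {q : N' → B} {x : N'}
    (hF : MDifferentiableAt (IA.prod IB) I F (p x, q x)) (hp : MDifferentiableAt I' IA p x)
    (hq : MDifferentiableAt I' IB q x) (v : E') :
    tangentMapAt I I' (fun y => F (p y, q y)) x v =
      tangentMapAt I IA (fun a => F (a, q x)) (p x) (tangentMapAt IA I' p x v) +
        tangentMapAt I IB (fun b => F (p x, b)) (q x) (tangentMapAt IB I' q x v) := by
  have h1 : tangentMapAt I I' (fun y => F (p y, q y)) x =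
      (tangentMapAt I (IA.prod IB) F (p x, q x)).comp
        (tangentMapAt (IA.prod IB) I' (fun y => (p y, q y)) x) :=
    tangentMapAt_comp (f := fun y => (p y, q y)) x hF (hp.prodMk hq)
  have h2 : tangentMapAt (IA.prod IB) I' (fun y => (p y, q y)) x =
      (tangentMapAt IA I' p x).prod (tangentMapAt IB I' q x) := mfderiv_prodMk hp hq
  rw [h1, h2]
  exact mfderiv_prod_eq_add_apply (p := (p x, q x))
    (v := ((tangentMapAt IA I' p x v, tangentMapAt IB I' q x v) : EA × EB)) hF

end ProductRule

/-! ### The Maurer–Cartan form and the adjoint action -/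

section LieGroup

variable {EG : Type*} [NormedAddCommGroup EG] [NormedSpace ℝ EG]
  {HG : Type*} [TopologicalSpace HG] {IG : ModelWithCorners ℝ EG HG}
  {G : Type*} [TopologicalSpace G] [ChartedSpace HG G] [Group G] [LieGroup IG ∞ G]
  {E : Type*} [NormedAddCommGroup E] [NormedSpace ℝ E]
  {H : Type*} [TopologicalSpace H] {I : ModelWithCorners ℝ E H}
  {N : Type*} [TopologicalSpace N] [ChartedSpace H N]

theorem mdifferentiableAt_mul (x : G × G) :
    MDifferentiableAt (IG.prod IG) IG (fun x : G × G => x.1 * x.2) x :=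
  mdifferentiableAt_of_contMDiffAt (contMDiff_mul IG ∞ x)

theorem mdifferentiableAt_mul_left (a x : G) : MDifferentiableAt IG IG (fun h : G => a * h) x :=
  mdifferentiableAt_of_contMDiffAt (contMDiff_mul_left (I := IG) (n := ∞) (a := a) x)

theorem contMDiff_conj (a : G) : ContMDiff IG IG ∞ (fun h : G => a * h * a⁻¹) :=
  contMDiff_mul_right.comp contMDiff_mul_left

variable (IG) in
/-- The left Maurer–Cartan form, with values in the model vector space. -/
def mcForm (g : G) : EG →L[ℝ] EG := tangentMapAt IG IG (fun h : G => g⁻¹ * h) g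

variable (IG) in
/-- The adjoint action on the model vector space. -/
def adMap (g : G) : EG →L[ℝ] EG := tangentMapAt IG IG (fun h : G => g * h * g⁻¹) 1

theorem mcForm_one : mcForm IG (1 : G) = ContinuousLinearMap.id ℝ EG := by
  have : (fun h : G => (1 : G)⁻¹ * h) = fun h => h := by
    funext h
    simp
  rw [mcForm, this, tangentMapAt_id]

theorem adMap_one : adMap IG (1 : G) = ContinuousLinearMap.id ℝ EG := by
  have : (fun h : G => (1 : G) * h * (1 : G)⁻¹) = fun h => h := by
    funext h
    simp
  rw [adMap, this, tangentMapAt_id]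

/-- The Maurer–Cartan form is left invariant. -/
theorem mcForm_mul_left (k g : G) :
    (mcForm IG (k * g)).comp (tangentMapAt IG IG (fun h : G => k * h) g) = mcForm IG g := by
  rw [mcForm, ← tangentMapAt_comp g (mdifferentiableAt_mul_left _ _)
    (mdifferentiableAt_mul_left _ _), mcForm]
  congr 1
  funext h
  group

/-- Because `(gk)⁻¹hk = k⁻¹(g⁻¹h)k`: differentiate in `h` at `g`, where `g⁻¹h` takes the value `1`.
-/
theorem mcForm_mul_right (k g : G) :
    (mcForm IG (g * k)).comp (tangentMapAt IG IG (fun h : G => h * k) g) =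
      (adMap IG k⁻¹).comp (mcForm IG g) := by
  have hr : MDifferentiableAt IG IG (fun h : G => h * k) g :=
    mdifferentiableAt_of_contMDiffAt (contMDiff_mul_right (I := IG) (n := ∞) (a := k) g)
  have hc : MDifferentiableAt IG IG (fun h : G => k⁻¹ * h * k⁻¹⁻¹) (g⁻¹ * g) :=
    mdifferentiableAt_of_contMDiffAt (contMDiff_conj k⁻¹ _)
  have h1 := tangentMapAt_comp (I'' := IG) (f := fun h : G => g⁻¹ * h) g hc
    (mdifferentiableAt_mul_left _ _)
  rw [mcForm, ← tangentMapAt_comp g (mdifferentiableAt_mul_left _ _) hr, adMap, mcForm]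
  rw [inv_mul_cancel] at h1
  rw [← h1]
  congr 1
  funext h
  group

/-- The pullback of the Maurer–Cartan form along a product of maps. -/
theorem mcForm_mul {p q : N → G} {x : N} (hp : MDifferentiableAt I IG p x)
    (hq : MDifferentiableAt I IG q x) (v : E) :
    mcForm IG (p x * q x) (tangentMapAt IG I (fun y => p y * q y) x v) =
      adMap IG (q x)⁻¹ (mcForm IG (p x) (tangentMapAt IG I p x v)) +
        mcForm IG (q x) (tangentMapAt IG I q x v) := by
  rw [tangentMapAt_prod (F := fun x : G × G => x.1 * x.2) (mdifferentiableAt_mul _) hp hq,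
    map_add]
  exact congrArg₂ (· + ·) (DFunLike.congr_fun (mcForm_mul_right (q x) (p x)) _)
    (DFunLike.congr_fun (mcForm_mul_left (p x) (q x)) _)

theorem mdifferentiableAt_inv (x : G) : MDifferentiableAt IG IG (fun h : G => h⁻¹) x :=
  mdifferentiableAt_of_contMDiffAt (contMDiff_inv IG ∞ x)

/-- The product formula applied to the constant map `g ↦ g g⁻¹`. At `g = 1` it yields that inversion
has derivative `-1`. -/
theorem adMap_mcForm_add_mcForm_inv (g : G) (v : EG) :
    adMap IG g (mcForm IG g v) +
      mcForm IG g⁻¹ (tangentMapAt IG IG (fun h : G => h⁻¹) g v) = 0 := by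
  have h := mcForm_mul (p := fun h : G => h) (q := fun h : G => h⁻¹) (x := g)
    (I := IG) mdifferentiableAt_id (mdifferentiableAt_inv g) v
  have h1 : (fun y : G => y * y⁻¹) = fun _ => 1 := by
    funext y
    simp
  rw [h1, tangentMapAt_const, tangentMapAt_id, inv_inv] at h
  simpa using h.symm

theorem tangentMapAt_inv_one (v : EG) :
    tangentMapAt IG IG (fun h : G => h⁻¹) 1 v = -v := by
  have h := adMap_mcForm_add_mcForm_inv (IG := IG) (1 : G) v
  rw [inv_one, mcForm_one, adMap_one] at h
  exact (neg_eq_of_add_eq_zero_right h).symm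

section Smoothness

variable [I.Boundaryless] [IsManifold I ∞ N]
  {E' : Type*} [NormedAddCommGroup E'] [NormedSpace ℝ E']
  {H' : Type*} [TopologicalSpace H'] {I' : ModelWithCorners ℝ E' H'}
  {N' : Type*} [TopologicalSpace N'] [ChartedSpace H' N'] [IsManifold I' ∞ N']
  {E'' : Type*} [NormedAddCommGroup E''] [NormedSpace ℝ E'']
  {H'' : Type*} [TopologicalSpace H''] {I'' : ModelWithCorners ℝ E'' H''}
  {N'' : Type*} [TopologicalSpace N''] [ChartedSpace H'' N''] [IsManifold I'' ∞ N'']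

theorem mfderiv_extChartAt_of_eq {x y : N'} (h : x = y) :
    tangentMapAt 𝓘(ℝ, E') I' (extChartAt I' x) y = ContinuousLinearMap.id ℝ E' := by
  subst h
  have : IsManifold I' 1 N' := IsManifold.of_le (n := ∞) (by simp)
  exact mfderiv_extChartAt_self

/-- Smooth dependence on parameters of the derivatives of a family of maps, at points
which are mapped to a fixed point. -/
theorem contMDiffAt_tangentMapAt_of_const {f : N'' → N → N'} {g : N'' → N} {c : N'}
    (hf : ContMDiff (I''.prod I) I' ∞ (Function.uncurry f)) (hg : ContMDiff I'' I ∞ g)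
    (hc : ∀ x, f x (g x) = c) (x₀ : N'') :
    ContMDiffAt I'' 𝓘(ℝ, E →L[ℝ] E') ∞ (fun x => (tangentMapAt I' I (f x) (g x)).comp
      (tangentMapAt I 𝓘(ℝ, E) (extChartAt I (g x₀)).symm (extChartAt I (g x₀) (g x)))) x₀ := by
  have : IsManifold I 1 N := IsManifold.of_le (n := ∞) (by simp)
  have : IsManifold I' 1 N' := IsManifold.of_le (n := ∞) (by simp)
  have : IsManifold I'' 1 N'' := IsManifold.of_le (n := ∞) (by simp)
  have h := ContMDiffAt.mfderiv (I := I) (I' := I') (x₀ := x₀) f g (hf _) (hg x₀)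
    (m := ∞) (n := ∞) (by simp)
  refine h.congr_of_eventuallyEq ?_
  have hsrc : ∀ᶠ x in 𝓝 x₀, g x ∈ (chartAt H (g x₀)).source :=
    (hg x₀).continuousAt.eventually_mem ((chartAt H (g x₀)).open_source.mem_nhds
      (mem_chart_source H (g x₀)))
  filter_upwards [hsrc] with x hx
  -- Since the image point is always `c`, the coordinate change on the target is the derivative of
  -- the chart at its centre, hence the identity; only the one on the source survives.
  rw [inTangentCoordinates_eq_mfderiv_comp hx (by rw [hc, hc]; exact mem_chart_source H' c)]
  have h1 := mfderiv_extChartAt_of_eq (I' := I') (x := f x₀ (g x₀)) (y := f x (g x))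
    (by rw [hc, hc])
  have h2 : tangentMapAt I 𝓘(ℝ, E) (extChartAt I (g x₀)).symm (extChartAt I (g x₀) (g x)) =
      mfderivWithin 𝓘(ℝ, E) I (extChartAt I (g x₀)).symm (range I)
        (extChartAt I (g x₀) (g x)) := by
    rw [I.range_eq_univ, mfderivWithin_univ]
    rfl
  have h3 := congrArg (fun L : E' →L[ℝ] E' => L.comp ((tangentMapAt I' I (f x) (g x)).comp
    (tangentMapAt I 𝓘(ℝ, E) (extChartAt I (g x₀)).symm (extChartAt I (g x₀) (g x))))) h1
  rw [h2] at h3 ⊢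
  exact h3.symm

end Smoothness

variable [IG.Boundaryless]

/-- Conjugations all fix `1`, so source and target are both constant and neither coordinate change
contributes. -/
theorem contMDiff_adMap : ContMDiff IG 𝓘(ℝ, EG →L[ℝ] EG) ∞ (adMap IG : G → EG →L[ℝ] EG) := by
  intro g₀
  have hf : ContMDiff (IG.prod IG) IG ∞ (Function.uncurry fun g h : G => g * h * g⁻¹) :=
    (contMDiff_fst.mul contMDiff_snd).mul contMDiff_fst.inv
  have h := contMDiffAt_tangentMapAt_of_const (I := IG) (I' := IG) (I'' := IG)
    hf (contMDiff_const (c := (1 : G))) (c := 1) (fun g => by simp) g₀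
  refine h.congr_of_eventuallyEq (Eventually.of_forall fun g => ?_)
  have h1 : tangentMapAt IG 𝓘(ℝ, EG) (extChartAt IG (1 : G)).symm (extChartAt IG (1 : G) 1) =
      ContinuousLinearMap.id ℝ EG := by
    have : IsManifold IG 1 G := IsManifold.of_le (n := ∞) (by simp)
    have := mfderivWithin_range_extChartAt_symm (I := IG) (x := (1 : G))
    rwa [IG.range_eq_univ, mfderivWithin_univ] at this
  simp only [h1]
  rfl

/-- Here the family is `h ↦ g⁻¹h` at the moving point `h = g`, with constant value `1`. The
remaining source coordinate change is the one in the chart representative of a form. -/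
theorem contDiffAt_mcForm_chart (g₀ : G) :
    ContDiffAt ℝ ∞ (fun y : EG => (mcForm IG ((extChartAt IG g₀).symm y)).comp
      (tangentMapAt IG 𝓘(ℝ, EG) (extChartAt IG g₀).symm y)) (extChartAt IG g₀ g₀) := by
  have hf : ContMDiff (IG.prod IG) IG ∞ (Function.uncurry fun g h : G => g⁻¹ * h) :=
    contMDiff_fst.inv.mul contMDiff_snd
  have h := contMDiffAt_tangentMapAt_of_const (I := IG) (I' := IG) (I'' := IG)
    hf contMDiff_id (c := 1) (fun g => by simp) g₀
  have hy := mem_extChartAt_target (I := IG) g₀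
  have hinv : (extChartAt IG g₀).symm (extChartAt IG g₀ g₀) = g₀ := extChartAt_to_inv g₀
  have h' := ContMDiffAt.comp_of_eq (f := (extChartAt IG g₀).symm) (x := extChartAt IG g₀ g₀) h
    (contMDiffAt_extChartAt_symm' hy) hinv
  refine h'.contDiffAt.congr_of_eventuallyEq ?_
  filter_upwards [(isOpen_extChartAt_target g₀).mem_nhds hy] with y hy'
  simp only [Function.comp_apply, id_eq, (extChartAt IG g₀).right_inv hy']
  rfl

variable [FiniteDimensional ℝ EG] {ι : Type*} [Fintype ι] [LinearOrder ι]
  (b : Module.Basis ι ℝ (GroupLieAlgebra IG G))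

theorem isSmoothForm_maurerCartanCoord (i : ι) :
    IsSmoothForm IG (maurerCartanCoord IG b i) := by
  refine isSmoothForm_of_contDiffAt fun g₀ => contDiffAt_alternating_of_apply fun v => ?_
  exact (coordCovector IG b i).contDiff.contDiffAt.comp _
    ((contDiffAt_mcForm_chart g₀).clm_apply (contDiffAt_const (c := v 0)))

/-- The matrix of the adjoint action in the basis `b`. -/
def adMatrix (i j : ι) (g : G) : ℝ := b.repr (Ad IG g (b j)) i

theorem contMDiff_adMatrix (i j : ι) : ContMDiff IG 𝓘(ℝ, ℝ) ∞ (adMatrix b i j) :=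
  (coordCovector IG b i).contMDiff.comp
    ((contMDiff_adMap (IG := IG) (G := G)).clm_apply (contMDiff_const (I' := 𝓘(ℝ, EG)) (M' := EG) (c := b j)))

theorem coordCovector_adMap (i : ι) (g : G) (v : EG) :
    coordCovector IG b i (adMap IG g v) = ∑ j, adMatrix b i j g * coordCovector IG b j v := by
  have h := congrArg (fun w : GroupLieAlgebra IG G => b.repr (Ad IG g w) i) (b.sum_repr v)
  simp only [map_sum, map_smul, Finsupp.coe_finsetSum, Finset.sum_apply, Finsupp.smul_apply,
    smul_eq_mul] at h
  refine (h.symm.trans (Finset.sum_congr rfl fun j _ => mul_comm _ _) : _)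

theorem maurerCartanCoord_apply (i : ι) (g : G) (v : Fin 1 → EG) :
    maurerCartanCoord IG b i g v = coordCovector IG b i (mcForm IG g (v 0)) := rfl

/-- The pullback of the coordinates of the Maurer–Cartan form along a product of maps. -/
theorem pullForm_mul_maurerCartanCoord {p q : N → G} (hp : ContMDiff I IG ∞ p)
    (hq : ContMDiff I IG ∞ q) (i : ι) :
    pullForm IG I (fun y => p y * q y) (maurerCartanCoord IG b i) =
      (∑ j, fun y => adMatrix b i j (q y)⁻¹ • pullForm IG I p (maurerCartanCoord IG b j) y) +
        pullForm IG I q (maurerCartanCoord IG b i) := by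
  funext x
  ext v
  have h := mcForm_mul (mdifferentiableAt_of_contMDiffAt (hp x))
    (mdifferentiableAt_of_contMDiffAt (hq x)) (v 0)
  simp only [pullForm, Pi.add_apply, Finset.sum_apply, ContinuousAlternatingMap.add_apply,
    ContinuousAlternatingMap.sum_apply, ContinuousAlternatingMap.smul_apply,
    ContinuousAlternatingMap.compContinuousLinearMap_apply, maurerCartanCoord_apply,
    Function.comp_apply, smul_eq_mul]
  rw [← coordCovector_adMap, ← map_add, ← h]

theorem pullForm_const {E' : Type*} [NormedAddCommGroup E'] [NormedSpace ℝ E']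
    {H' : Type*} [TopologicalSpace H'] {I' : ModelWithCorners ℝ E' H'}
    {N' : Type*} [TopologicalSpace N'] [ChartedSpace H' N'] {l : ℕ} (c : N')
    (η : N' → E' [⋀^Fin (l + 1)]→L[ℝ] ℝ) : pullForm I' I (fun _ : N => c) η = 0 := by
  funext x
  ext v
  simp only [pullForm, tangentMapAt_const, ContinuousAlternatingMap.compContinuousLinearMap_apply]
  exact (η c).map_coord_zero 0 rfl

theorem adMatrix_one (i j : ι) : adMatrix b i j (1 : G) = if i = j then 1 else 0 := by
  have : Ad IG (1 : G) (b j) = b j := DFunLike.congr_fun (adMap_one (IG := IG) (G := G)) (b j)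
  rw [adMatrix, this, b.repr_self, Finsupp.single_apply]
  simp [eq_comm]

/-- The derivative of the Maurer–Cartan form at `1`, in terms of the derivative of the adjoint
action. -/
theorem two_smul_extD_maurerCartanCoord_one (i : ι) :
    (2 : ℝ) • extD IG (maurerCartanCoord IG b i) (1 : G) =
      -∑ j, wedge (differential IG (adMatrix b i j) 1) (maurerCartanCoord IG b j 1) := by
  have hθ (j : ι) := isSmoothForm_maurerCartanCoord b j
  have hs (j : ι) : IsSmoothForm IG fun y => adMatrix b i j y • maurerCartanCoord IG b j y :=
    (hθ j).smul (contMDiff_adMatrix b i j)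
  have hinv : ContMDiff IG IG ∞ fun g : G => g⁻¹ := contMDiff_inv IG ∞
  -- With `p = id` and `q` the inversion the product is constant, so `0 = ∑ j, Ad_ij(g) θ_j +
  -- inv^*θ_i`; this is then differentiated at `1`.
  have h := pullForm_mul_maurerCartanCoord b (contMDiff_id (I := IG) (M := G)) hinv i
  have h1 : (fun y : G => id y * y⁻¹) = fun _ => 1 := by
    funext y
    simp
  have h2 (j : ι) : pullForm IG IG id (maurerCartanCoord IG b j) = maurerCartanCoord IG b j :=
    pullForm_id _
  simp only [h1, h2, inv_inv] at h
  rw [pullForm_const] at h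
  have h3 := congrFun (congrArg (extD IG) h) 1
  rw [extD_zero, extD_add (IsSmoothForm.sum _ fun j _ => hs j) ((hθ i).pullForm hinv),
    extD_sum _ fun j _ => hs j, extD_pullForm hinv (hθ i), Pi.add_apply, Finset.sum_apply] at h3
  -- Inversion acts by `-1` on the tangent space at `1`, and the two signs cancel on a 2-form. This
  -- is the second copy of `dθ_i`.
  have h4 : pullForm IG IG (fun g : G => g⁻¹) (extD IG (maurerCartanCoord IG b i)) 1 =
      extD IG (maurerCartanCoord IG b i) 1 := by
    ext v
    simp only [pullForm, ContinuousAlternatingMap.compContinuousLinearMap_apply, inv_one]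
    have : (⇑(tangentMapAt IG IG (fun g : G => g⁻¹) 1) ∘ v) = fun k => (-1 : ℝ) • v k := by
      funext k
      rw [Function.comp_apply, tangentMapAt_inv_one, neg_one_smul]
    rw [this, ContinuousAlternatingMap.map_smul_univ]
    simp
  have h5 : ∑ j, adMatrix b i j (1 : G) • extD IG (maurerCartanCoord IG b j) 1 =
      extD IG (maurerCartanCoord IG b i) 1 := by
    simp [adMatrix_one]
  simp only [extD_smul (contMDiff_adMatrix b i _) (hθ _), Finset.sum_add_distrib] at h3
  rw [h4, h5] at h3
  rw [two_smul, eq_neg_iff_add_eq_zero]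
  refine Eq.trans ?_ h3.symm
  abel

/-- The derivative of the Maurer–Cartan form is left invariant. -/
theorem extD_maurerCartanCoord (i : ι) (g : G) :
    extD IG (maurerCartanCoord IG b i) g =
      (extD IG (maurerCartanCoord IG b i) 1).compContinuousLinearMap (mcForm IG g) := by
  have hl : ContMDiff IG IG ∞ fun h : G => g⁻¹ * h := contMDiff_mul_left
  have h1 : pullForm IG IG (fun h : G => g⁻¹ * h) (maurerCartanCoord IG b i) =
      maurerCartanCoord IG b i := by
    funext x
    ext v
    simp only [pullForm, ContinuousAlternatingMap.compContinuousLinearMap_apply,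
      maurerCartanCoord_apply, Function.comp_apply]
    exact congrArg _ (DFunLike.congr_fun (mcForm_mul_left g⁻¹ x) (v 0))
  have h2 := congrFun (extD_pullForm hl (isSmoothForm_maurerCartanCoord b i)) g
  rw [h1] at h2
  rw [h2, pullForm, inv_mul_cancel]
  rfl

end LieGroup

/-! ### Evaluation of 2-forms on pairs of vectors -/

section TwoForms

variable {V : Type*} [NormedAddCommGroup V] [NormedSpace ℝ V] (Ω : V [⋀^Fin 2]→L[ℝ] ℝ)

theorem twoForm_add_left (u u' w : V) : Ω ![u + u', w] = Ω ![u, w] + Ω ![u', w] := by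
  have h := DFunLike.congr_fun (map_add Ω.curryLeft u u') ![w]
  exact h

theorem twoForm_sum_smul_left {κ : Type*} (s : Finset κ) (c : κ → ℝ) (u : κ → V) (w : V) :
    Ω ![∑ i ∈ s, c i • u i, w] = ∑ i ∈ s, c i * Ω ![u i, w] := by
  have h : Ω.curryLeft (∑ i ∈ s, c i • u i) ![w] = ∑ i ∈ s, c i * Ω.curryLeft (u i) ![w] := by
    simp only [map_sum, map_smul, ContinuousAlternatingMap.sum_apply,
      ContinuousAlternatingMap.smul_apply, smul_eq_mul]
  exact h

theorem twoForm_swap (u w : V) : Ω ![u, w] = -Ω ![w, u] := by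
  have h := Ω.toAlternatingMap.map_swap ![w, u] (i := 0) (j := 1) (by simp)
  have h2 : ![w, u] ∘ ⇑(Equiv.swap (0 : Fin 2) 1) = ![u, w] := by
    funext i
    fin_cases i <;> simp
  rw [h2] at h
  exact h

theorem twoForm_add_right (u w w' : V) : Ω ![u, w + w'] = Ω ![u, w] + Ω ![u, w'] := by
  rw [twoForm_swap, twoForm_add_left, twoForm_swap Ω w, twoForm_swap Ω w']
  ring

theorem wedge_oneForm_apply (α : V →L[ℝ] ℝ) (η : V [⋀^Fin 1]→L[ℝ] ℝ) (v w : V) :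
    wedge α η ![v, w] = α v * η ![w] - α w * η ![v] := by
  rw [wedge_apply, Fin.sum_univ_two]
  have h0 : (0 : Fin 2).removeNth ![v, w] = ![w] := by
    funext i
    fin_cases i
    rfl
  have h1 : (1 : Fin 2).removeNth ![v, w] = ![v] := by
    funext i
    fin_cases i
    rfl
  rw [h0, h1]
  simp
  ring

theorem comp_pair {V' : Type*} [NormedAddCommGroup V'] [NormedSpace ℝ V'] (A : V' →L[ℝ] V)
    (v w : V') : Ω.compContinuousLinearMap A ![v, w] = Ω ![A v, A w] := by
  rw [ContinuousAlternatingMap.compContinuousLinearMap_apply]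
  congr 1
  funext i
  fin_cases i <;> rfl

end TwoForms

/-! ### Differentials of functions -/

section Differential

variable {E : Type*} [NormedAddCommGroup E] [NormedSpace ℝ E]
  {H : Type*} [TopologicalSpace H] {I : ModelWithCorners ℝ E H}
  {N : Type*} [TopologicalSpace N] [ChartedSpace H N]

theorem differential_add {f g : N → ℝ} {x : N} (hf : MDifferentiableAt I 𝓘(ℝ, ℝ) f x)
    (hg : MDifferentiableAt I 𝓘(ℝ, ℝ) g x) :
    differential I (f + g) x = differential I f x + differential I g x :=
  mfderiv_add hf hg

theorem differential_mul_const {f : N → ℝ} {x : N} (hf : MDifferentiableAt I 𝓘(ℝ, ℝ) f x)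
    (c : ℝ) : differential I (fun y => f y * c) x = c • differential I f x := by
  have h : (fun y => f y * c) = c • f := by
    funext y
    exact mul_comm _ _
  rw [h]
  exact (hf.hasMFDerivAt.const_smul c).mfderiv

theorem differential_sum_mul_const {κ : Type*} (s : Finset κ) {f : κ → N → ℝ} (c : κ → ℝ) {x : N}
    (hf : ∀ i ∈ s, MDifferentiableAt I 𝓘(ℝ, ℝ) (f i) x) :
    differential I (fun y => ∑ i ∈ s, f i y * c i) x = ∑ i ∈ s, c i • differential I (f i) x := by
  classical
  suffices MDifferentiableAt I 𝓘(ℝ, ℝ) (fun y => ∑ i ∈ s, f i y * c i) x ∧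
      differential I (fun y => ∑ i ∈ s, f i y * c i) x = ∑ i ∈ s, c i • differential I (f i) x from
    this.2
  induction s using Finset.induction_on with
  | empty =>
    simp only [Finset.sum_empty]
    exact ⟨mdifferentiableAt_const, mfderiv_const⟩
  | insert i s hi ih =>
    have hfi := hf i (Finset.mem_insert_self i s)
    have hfi' : MDifferentiableAt I 𝓘(ℝ, ℝ) (fun y => f i y * c i) x :=
      hfi.mul mdifferentiableAt_const
    obtain ⟨h1, h2⟩ := ih fun j hj => hf j (Finset.mem_insert_of_mem hj)
    simp only [Finset.sum_insert hi]
    refine ⟨hfi'.add h1, ?_⟩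
    rw [← h2, ← differential_mul_const hfi]
    exact differential_add hfi' h1

end Differential

/-! ### The moment map and the pullback of the symplectic form along the action -/

section MomentMap

variable {EG : Type*} [NormedAddCommGroup EG] [NormedSpace ℝ EG] [FiniteDimensional ℝ EG]
  {HG : Type*} [TopologicalSpace HG] {IG : ModelWithCorners ℝ EG HG} [IG.Boundaryless]
  {G : Type*} [TopologicalSpace G] [ChartedSpace HG G] [Group G] [LieGroup IG ∞ G]
  {EM : Type*} [NormedAddCommGroup EM] [NormedSpace ℝ EM]
  {HM : Type*} [TopologicalSpace HM] {IM : ModelWithCorners ℝ EM HM}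
  {M : Type*} [TopologicalSpace M] [ChartedSpace HM M]
  [MulAction G M] [ContMDiffSMul IG IM ∞ G M]
  {E : Type*} [NormedAddCommGroup E] [NormedSpace ℝ E]
  {H : Type*} [TopologicalSpace H] {I : ModelWithCorners ℝ E H}
  {N : Type*} [TopologicalSpace N] [ChartedSpace H N]

variable (IG IM) in
/-- The infinitesimal action, as a linear map of model vector spaces. -/
def orbitMap (m : M) : EG →L[ℝ] EM := tangentMapAt IM IG (fun g : G => g • m) 1

theorem contMDiff_orbit (m : M) : ContMDiff IG IM ∞ fun g : G => g • m :=
  contMDiff_id.smul contMDiff_const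

theorem contMDiff_translate (IG : ModelWithCorners ℝ EG HG) [ContMDiffSMul IG IM ∞ G M] (g : G) : ContMDiff IM IM ∞ fun m : M => g • m :=
  ContMDiffSMul.contMDiff_const_smul (I := IG) g

/-- The derivative of the action along a pair of maps. -/
theorem tangentMapAt_smul {p : N → G} {q : N → M} {x : N} (hp : MDifferentiableAt I IG p x)
    (hq : MDifferentiableAt I IM q x) (v : E) :
    tangentMapAt IM I (fun y => p y • q y) x v =
      tangentMapAt IM IM (fun m : M => p x • m) (q x)
        (orbitMap IG IM (G := G) (q x) (mcForm IG (p x) (tangentMapAt IG I p x v)) +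
          tangentMapAt IM I q x v) := by
  have hF : MDifferentiableAt (IG.prod IM) IM (fun z : G × M => z.1 • z.2) (p x, q x) :=
    mdifferentiableAt_of_contMDiffAt (ContMDiffSMul.contMDiff_smul _)
  rw [tangentMapAt_prod (F := fun z : G × M => z.1 • z.2) hF hp hq, map_add]
  -- Moving the group variable to `1` by a left translation brings in the Maurer–Cartan form and
  -- factors out the translation by `p x`.
  have h1 : (fun g : G => g • q x) = fun g : G => p x • ((p x)⁻¹ * g) • q x := by
    funext g
    rw [smul_smul, mul_inv_cancel_left]
  have h2 := tangentMapAt_comp (I := IM) (I' := IM) (I'' := IG) (g := fun m : M => p x • m)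
    (f := fun g : G => ((p x)⁻¹ * g) • q x) (p x)
    (mdifferentiableAt_of_contMDiffAt (contMDiff_translate IG (p x) _))
    (mdifferentiableAt_of_contMDiffAt
      ((contMDiff_orbit (q x)).comp (contMDiff_mul_left (a := (p x)⁻¹)) (p x)))
  have h3 := tangentMapAt_comp (I := IM) (I' := IG) (I'' := IG) (g := fun g : G => g • q x)
    (f := fun g : G => (p x)⁻¹ * g) (p x)
    (mdifferentiableAt_of_contMDiffAt (contMDiff_orbit (q x) _))
    (mdifferentiableAt_mul_left _ _)
  rw [inv_mul_cancel] at h3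
  rw [h3, inv_mul_cancel, one_smul] at h2
  simp only
  rw [h1, h2]
  rfl

variable {ι : Type*} [Fintype ι] [LinearOrder ι] (b : Module.Basis ι ℝ (GroupLieAlgebra IG G))

/-- A basis vector of the Lie algebra, in the model vector space. -/
def basisVector (i : ι) : EG := b i

theorem sum_coordCovector_smul (v : EG) :
    ∑ i, coordCovector IG b i v • basisVector b i = v :=
  b.sum_repr v

theorem twoForm_orbitMap_left (σ : EM [⋀^Fin 2]→L[ℝ] ℝ) (m : M) (X : EG) (w : EM) :
    σ ![orbitMap IG IM (G := G) m X, w] =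
      ∑ i, coordCovector IG b i X * σ ![infinitesimalAction IG IM (b i) m, w] := by
  have h := congrArg (fun Y : EG => σ ![orbitMap IG IM (G := G) m Y, w])
    (sum_coordCovector_smul b X)
  simp only [map_sum, map_smul] at h
  rw [twoForm_sum_smul_left] at h
  exact h.symm

variable {Ω : M → EM [⋀^Fin 2]→L[ℝ] ℝ} {μ : M → Module.Dual ℝ (GroupLieAlgebra IG G)}

/-- Equivariance at `g⁻¹` produces `Ad g`, whose matrix is the one occurring in the formula for `dθ`
at `1`. -/
theorem moment_inv_smul (hμ : IsHamiltonian IG IM Ω μ) (g : G) (m : M) (j : ι) :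
    μ (g⁻¹ • m) (b j) = ∑ i, adMatrix b i j g * μ m (b i) := by
  rw [hμ.equivariant, inv_inv]
  have h := congrArg (μ m) (b.sum_repr (Ad IG g (b j)))
  simp only [map_sum, map_smul, smul_eq_mul] at h
  exact h.symm

theorem mdifferentiableAt_moment (hμ : IsHamiltonian IG IM Ω μ) (X : GroupLieAlgebra IG G)
    (m : M) : MDifferentiableAt IM 𝓘(ℝ, ℝ) (fun m => μ m X) m :=
  mdifferentiableAt_of_contMDiffAt (hμ.smooth X m)

/-- The infinitesimal form of the equivariance of the moment map. -/
theorem sum_moment_differential_adMatrix (hμ : IsHamiltonian IG IM Ω μ) (m : M) (j : ι) (Y : EG) :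
    ∑ i, μ m (b i) * differential IG (adMatrix b i j) 1 Y =
      -Ω m ![infinitesimalAction IG IM (b j) m, orbitMap IG IM (G := G) m Y] := by
  have h1 : (fun g : G => μ (g⁻¹ • m) (b j)) = fun g => ∑ i, adMatrix b i j g * μ m (b i) :=
    funext fun g => moment_inv_smul b hμ g m j
  have hinv : MDifferentiableAt IG IG (fun g : G => g⁻¹) 1 := mdifferentiableAt_inv 1
  have h2 := tangentMapAt_comp (I := IM) (I' := IG) (I'' := IG) (g := fun g : G => g • m)
    (f := fun g : G => g⁻¹) 1 (mdifferentiableAt_of_contMDiffAt (contMDiff_orbit m _)) hinv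
  have h3 := differential_comp (I' := IM) (I'' := IG) (g := fun m => μ m (b j))
    (f := fun g : G => g⁻¹ • m) 1 (mdifferentiableAt_moment hμ _ _)
    (mdifferentiableAt_of_contMDiffAt
      ((contMDiff_orbit m).comp (contMDiff_inv IG ∞) 1))
  rw [h2, inv_one, one_smul] at h3
  have h4 : differential IG (fun g => ∑ i, adMatrix b i j g * μ m (b i)) 1 Y =
      ∑ i, μ m (b i) * differential IG (adMatrix b i j) 1 Y := by
    rw [differential_sum_mul_const _ _ fun i _ =>
      mdifferentiableAt_of_contMDiffAt (contMDiff_adMatrix b i j (1 : G))]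
    simp only [sum_apply, smul_apply, smul_eq_mul]
  -- The derivative at `1` of `g ↦ μ (g⁻¹ • m) (b j)` is computed in two ways; the minus sign is
  -- that of inversion.
  rw [← h4, ← h1, h3, ContinuousLinearMap.comp_apply, ContinuousLinearMap.comp_apply,
    tangentMapAt_inv_one, map_neg, map_neg, ← hμ.hamilton]
  rfl

/-- The pairing of the moment map with the derivative of the Maurer–Cartan form. -/
theorem sum_moment_extD_maurerCartanCoord (hμ : IsHamiltonian IG IM Ω μ) (m : M) (g : G)
    (v w : EG) :
    ∑ i, μ m (b i) * extD IG (maurerCartanCoord IG b i) g ![v, w] =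
      -Ω m ![orbitMap IG IM (G := G) m (mcForm IG g v),
        orbitMap IG IM (G := G) m (mcForm IG g w)] := by
  have key (X Y : EG) : ∑ i, μ m (b i) * extD IG (maurerCartanCoord IG b i) 1 ![X, Y] =
      -Ω m ![orbitMap IG IM (G := G) m X, orbitMap IG IM (G := G) m Y] := by
    have h1 (i : ι) : 2 * (μ m (b i) * extD IG (maurerCartanCoord IG b i) 1 ![X, Y]) =
        ∑ j, (coordCovector IG b j X * (μ m (b i) * differential IG (adMatrix b i j) 1 Y) -
          coordCovector IG b j Y * (μ m (b i) * differential IG (adMatrix b i j) 1 X)) := by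
      have h := DFunLike.congr_fun (two_smul_extD_maurerCartanCoord_one b i) ![X, Y]
      simp only [ContinuousAlternatingMap.smul_apply, ContinuousAlternatingMap.neg_apply,
        ContinuousAlternatingMap.sum_apply, wedge_oneForm_apply, maurerCartanCoord_apply,
        mcForm_one, smul_eq_mul] at h
      rw [mul_left_comm, h, ← Finset.sum_neg_distrib, Finset.mul_sum]
      refine Finset.sum_congr rfl fun j _ => ?_
      simp only [Matrix.cons_val_zero, ContinuousLinearMap.id_apply]
      ring
    have h2 : 2 * ∑ i, μ m (b i) * extD IG (maurerCartanCoord IG b i) 1 ![X, Y] =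
        2 * -Ω m ![orbitMap IG IM (G := G) m X, orbitMap IG IM (G := G) m Y] := by
      rw [Finset.mul_sum]
      simp only [h1]
      -- Summing over `i` first turns the coefficients into values of `ω` on `b_j♯`; the sum over
      -- `j` then reassembles `X♯` and `Y♯`.
      rw [Finset.sum_comm]
      simp only [Finset.sum_sub_distrib, ← Finset.mul_sum,
        sum_moment_differential_adMatrix b hμ, mul_neg, Finset.sum_neg_distrib]
      rw [← twoForm_orbitMap_left, ← twoForm_orbitMap_left,
        twoForm_swap (Ω m) (orbitMap IG IM (G := G) m Y)]
      ring
    linarith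
  have h (i : ι) : extD IG (maurerCartanCoord IG b i) g ![v, w] =
      extD IG (maurerCartanCoord IG b i) 1 ![mcForm IG g v, mcForm IG g w] := by
    rw [extD_maurerCartanCoord b i g]
    exact comp_pair _ _ _ _
  simp only [h]
  exact key _ _

variable [I.Boundaryless] [IsManifold I ∞ N] [FiniteDimensional ℝ E]

/-- The difference of the pullbacks of the form along the projection and along the action is the
exterior derivative of the pairing of the moment map with the Maurer–Cartan form. -/
theorem pullForm_sub_pullForm_smul (hμ : IsHamiltonian IG IM Ω μ) {p : N → G} {q : N → M}
    (hp : ContMDiff I IG ∞ p) (hq : ContMDiff I IM ∞ q) (x : N) :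
    pullForm IM I q Ω x - pullForm IM I (fun y => p y • q y) Ω x =
      ∑ i, (μ (q x) (b i) • extD I (pullForm IG I p (maurerCartanCoord IG b i)) x +
        wedge (differential I (fun y => μ (q y) (b i)) x)
          (pullForm IG I p (maurerCartanCoord IG b i) x)) := by
  have hpx := mdifferentiableAt_of_contMDiffAt (hp x)
  have hqx := mdifferentiableAt_of_contMDiffAt (hq x)
  ext v
  obtain ⟨v, w, rfl⟩ : ∃ u w, v = ![u, w] := ⟨v 0, v 1, by
    funext i
    fin_cases i <;> rfl⟩
  have hinv (u u' : EM) : Ω (p x • q x)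
      ![tangentMapAt IM IM (fun m : M => p x • m) (q x) u,
        tangentMapAt IM IM (fun m : M => p x • m) (q x) u'] = Ω (q x) ![u, u'] := by
    rw [← comp_pair]
    exact DFunLike.congr_fun (congrFun (hμ.invariant (p x)) (q x)) ![u, u']
  have hdμ (i : ι) (u : E) : differential I (fun y => μ (q y) (b i)) x u =
      Ω (q x) ![infinitesimalAction IG IM (b i) (q x), tangentMapAt IM I q x u] := by
    rw [hμ.hamilton, differential_comp (g := fun m => μ m (b i)) x
      (mdifferentiableAt_moment hμ _ _) hqx]
    rfl
  have hθ (i : ι) (u : E) : pullForm IG I p (maurerCartanCoord IG b i) x ![u] =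
      coordCovector IG b i (mcForm IG (p x) (tangentMapAt IG I p x u)) := rfl
  have hdθ (i : ι) : extD I (pullForm IG I p (maurerCartanCoord IG b i)) x ![v, w] =
      extD IG (maurerCartanCoord IG b i) (p x)
        ![tangentMapAt IG I p x v, tangentMapAt IG I p x w] := by
    rw [extD_pullForm hp (isSmoothForm_maurerCartanCoord b i)]
    exact comp_pair _ _ _ _
  simp only [hdθ,
    ContinuousAlternatingMap.sub_apply, ContinuousAlternatingMap.sum_apply,
    ContinuousAlternatingMap.add_apply, ContinuousAlternatingMap.smul_apply, smul_eq_mul,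
    wedge_oneForm_apply, hdμ, hθ]
  simp only [pullForm, comp_pair, tangentMapAt_smul hpx hqx, hinv]
  -- The first sum becomes the vertical term `-ω(X♯, Y♯)`; the second gives the mixed terms.
  -- Bilinear expansion of the left side finishes, up to one use of antisymmetry.
  rw [Finset.sum_add_distrib, sum_moment_extD_maurerCartanCoord b hμ, Finset.sum_sub_distrib]
  simp only [mul_comm (Ω (q x) _)]
  rw [← twoForm_orbitMap_left, ← twoForm_orbitMap_left]
  simp only [twoForm_add_left, twoForm_add_right]
  rw [twoForm_swap (Ω (q x)) (tangentMapAt IM I q x v) (orbitMap IG IM (q x) _)]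
  ring

end MomentMap

/-! ### Manifold structure on the powers of the group -/

section PowerManifolds

variable {EG : Type u} [NormedAddCommGroup EG] [NormedSpace ℝ EG]
  {HG : Type v} [TopologicalSpace HG] {IG : ModelWithCorners ℝ EG HG}
  {G : Type*} [TopologicalSpace G] [ChartedSpace HG G]

instance finiteDimensional_powE [FiniteDimensional ℝ EG] :
    ∀ r, FiniteDimensional ℝ (PowE EG r)
  | 0 => inferInstanceAs (FiniteDimensional ℝ PUnit)
  | r + 1 =>
    have : FiniteDimensional ℝ (PowE EG r) := finiteDimensional_powE r
    inferInstanceAs (FiniteDimensional ℝ (EG × PowE EG r))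

instance boundaryless_powModel [IG.Boundaryless] : ∀ r, (powModel IG r).Boundaryless
  | 0 => ⟨Set.eq_univ_of_forall fun _ => ⟨PUnit.unit, rfl⟩⟩
  | r + 1 =>
    have : (powModel IG r).Boundaryless := boundaryless_powModel r
    inferInstanceAs (IG.prod (powModel IG r)).Boundaryless

instance isManifold_pow [IsManifold IG ∞ G] : ∀ r, IsManifold (powModel IG r) ∞ (Pow G r)
  | 0 => by
    have : Subsingleton (PowE EG 0) := inferInstanceAs (Subsingleton PUnit)
    exact isManifold_of_contDiffOn _ _ _ fun _ _ _ _ => contDiff_of_subsingleton.contDiffOn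
  | r + 1 =>
    have : IsManifold (powModel IG r) ∞ (Pow G r) := isManifold_pow r
    inferInstanceAs (IsManifold (IG.prod (powModel IG r)) ∞ (G × Pow G r))

variable {E : Type*} [NormedAddCommGroup E] [NormedSpace ℝ E]
  {H : Type*} [TopologicalSpace H] {I : ModelWithCorners ℝ E H}
  {N : Type*} [TopologicalSpace N] [ChartedSpace H N]

theorem ContMDiff.powHead {r : ℕ} {f : N → Pow G (r + 1)}
    (hf : ContMDiff I (powModel IG (r + 1)) ∞ f) : ContMDiff I IG ∞ fun x => (f x).1 := by
  have hf' : ContMDiff I (IG.prod (powModel IG r)) ∞ (M' := G × Pow G r) f := hf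
  exact contMDiff_fst.comp hf'

theorem ContMDiff.powTail {r : ℕ} {f : N → Pow G (r + 1)}
    (hf : ContMDiff I (powModel IG (r + 1)) ∞ f) :
    ContMDiff I (powModel IG r) ∞ fun x => (f x).2 := by
  have hf' : ContMDiff I (IG.prod (powModel IG r)) ∞ (M' := G × Pow G r) f := hf
  exact contMDiff_snd.comp hf'

theorem ContMDiff.powCons {r : ℕ} {f : N → G} {g : N → Pow G r} (hf : ContMDiff I IG ∞ f)
    (hg : ContMDiff I (powModel IG r) ∞ g) :
    ContMDiff I (powModel IG (r + 1)) ∞ (M' := Pow G (r + 1)) fun x => (f x, g x) := by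
  have h : ContMDiff I (IG.prod (powModel IG r)) ∞ fun x => (f x, g x) := hf.prodMk hg
  exact h

end PowerManifolds

/-! ### Graded pullback and smoothness of components -/

section GradedPull

variable {ι : Type*} [Fintype ι] [LinearOrder ι]
  {E : Type*} [NormedAddCommGroup E] [NormedSpace ℝ E]
  {H : Type*} [TopologicalSpace H] {I : ModelWithCorners ℝ E H} [I.Boundaryless]
  {N : Type*} [TopologicalSpace N] [ChartedSpace H N] [IsManifold I ∞ N]
  {E' : Type*} [NormedAddCommGroup E'] [NormedSpace ℝ E'] [FiniteDimensional ℝ E']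
  {H' : Type*} [TopologicalSpace H'] {I' : ModelWithCorners ℝ E' H'} [I'.Boundaryless]
  {N' : Type*} [TopologicalSpace N'] [ChartedSpace H' N'] [IsManifold I' ∞ N']

theorem gradedPull_zero (f : N' → N) (c : ι → ι → N' → ℝ) :
    gradedPull I I' f c (0 : N → Fib ι E) = 0 :=
  funext fun _ => fibPull_zero _ _ _

theorem gradedPull_ofDegree (f : N' → N) (c : ι → ι → N' → ℝ) {k : ℕ}
    (η : N → E [⋀^Fin k]→L[ℝ] ℝ) :
    gradedPull I I' f c (fun y => (ofDegree (η y) : Fib ι E)) =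
      fun x => ofDegree (pullForm I I' f η x) :=
  funext fun _ => fibPull_ofDegree _ _ _ _

/-- The pullback of the derivative of `∑ i, E_i * ζ i` is the derivative of the pullback. -/
theorem gradedPull_lin_extD {f : N' → N} (hf : ContMDiff I' I ∞ f) {c : ι → ι → N' → ℝ}
    (hc : ∀ a i, ContMDiff I' 𝓘(ℝ, ℝ) ∞ (c a i)) {ζ : ι → N → E [⋀^Fin 1]→L[ℝ] ℝ}
    (hζ : ∀ i, IsSmoothForm I (ζ i)) {B : ι → N' → E' [⋀^Fin 1]→L[ℝ] ℝ}
    (hB : ∀ a, B a = ∑ i, fun x => c a i x • pullForm I I' f (ζ i) x) :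
    gradedPull I I' f c (fun y => (lin (fun i => extD I (ζ i) y) fun i => ζ i y : Fib ι E)) =
      fun x => lin (fun a => extD I' (B a) x) fun a => B a x := by
  funext x
  rw [gradedPull, fibPull_lin]
  congr 1
  · funext a
    have hs (i : ι) := (hζ i).pullForm hf
    rw [hB, extD_sum _ fun i _ => (hs i).smul (hc a i), Finset.sum_apply]
    refine Finset.sum_congr rfl fun i _ => ?_
    rw [extD_smul (hc a i) (hs i), extD_pullForm hf (hζ i), add_comm]
    rfl
  · funext a
    rw [hB, Finset.sum_apply]
    rfl

/-- Constant scalars pass through the derivative unconditionally, so `η` need not be smooth here,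
unlike in `extD_smul`. -/
theorem extD_const_smul {l : ℕ} (s : ℝ) (η : N → E [⋀^Fin l]→L[ℝ] ℝ) :
    extD I (s • η) = s • extD I η := by
  funext x
  have h : chartRep I (s • η) x = s • chartRep I η x := rfl
  rw [extD, h, extDeriv_smul]
  rfl

theorem IsSmoothForm.const_smul {l : ℕ} (s : ℝ) {η : N → E [⋀^Fin l]→L[ℝ] ℝ}
    (hη : IsSmoothForm I η) : IsSmoothForm I (s • η) :=
  hη.smul (c := fun _ => s) contMDiff_const

theorem isSmoothForm_homog {k : ℕ} {η : N → E [⋀^Fin k]→L[ℝ] ℝ} (hη : IsSmoothForm I η) (l : ℕ) :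
    IsSmoothForm I fun y => homog (η y) l := by
  by_cases h : l = k
  · subst h
    simpa using hη
  · have : (fun y => homog (η y) l) = 0 := funext fun y => homog_of_ne _ h
    rw [this]
    exact isSmoothForm_zero

theorem isSmoothForm_ofDegree {k : ℕ} {η : N → E [⋀^Fin k]→L[ℝ] ℝ} (hη : IsSmoothForm I η)
    (J : Finset ι) (K : ι → ℕ) (l : ℕ) :
    IsSmoothForm I fun y => (ofDegree (η y) : Fib ι E) J K l := by
  simp only [ofDegree_apply]
  split_ifs
  · exact isSmoothForm_homog hη l
  · exact isSmoothForm_zero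

theorem isSmoothForm_lin {η : ι → N → E [⋀^Fin 2]→L[ℝ] ℝ} (hη : ∀ i, IsSmoothForm I (η i))
    {ζ : ι → N → E [⋀^Fin 1]→L[ℝ] ℝ} (hζ : ∀ i, IsSmoothForm I (ζ i))
    (J : Finset ι) (K : ι → ℕ) (l : ℕ) :
    IsSmoothForm I fun y => (lin (fun i => η i y) fun i => ζ i y : Fib ι E) J K l := by
  rcases linear_cases J K with ⟨j, rfl, rfl⟩ | ⟨j, rfl, rfl⟩ | ⟨h1, h2⟩
  · simp only [lin_singleton]
    exact isSmoothForm_homog (hη j) l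
  · simp only [lin_empty_single]
    exact isSmoothForm_homog (hζ j) l
  · simp only [lin_eq_zero h1 h2]
    exact isSmoothForm_zero

end GradedPull

/-! ### The reduced form in the Bott–Shulman complex -/

section Complex

variable {EG : Type u} [NormedAddCommGroup EG] [NormedSpace ℝ EG] [FiniteDimensional ℝ EG]
  {HG : Type v} [TopologicalSpace HG] {IG : ModelWithCorners ℝ EG HG} [IG.Boundaryless]
  {G : Type*} [TopologicalSpace G] [ChartedSpace HG G] [Group G] [LieGroup IG ∞ G]
  {EM : Type*} [NormedAddCommGroup EM] [NormedSpace ℝ EM] [FiniteDimensional ℝ EM]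
  {HM : Type*} [TopologicalSpace HM] {IM : ModelWithCorners ℝ EM HM} [IM.Boundaryless]
  {M : Type*} [TopologicalSpace M] [ChartedSpace HM M] [IsManifold IM ∞ M]
  [MulAction G M] [ContMDiffSMul IG IM ∞ G M]
  {ι : Type*} [Fintype ι] [LinearOrder ι] (b : Module.Basis ι ℝ (GroupLieAlgebra IG G))

variable (IM M) in
/-- The components of the Maurer–Cartan form, pulled back to `G × M`. -/
def thetaCoord (i : ι) :
    Pow G 1 × M → (PowE EG 1 × EM) [⋀^Fin 1]→L[ℝ] ℝ :=
  pullForm IG ((powModel IG 1).prod IM) (fun z : Pow G 1 × M => z.1.1) (maurerCartanCoord IG b i)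

theorem contMDiff_firstFactor (r : ℕ) :
    ContMDiff ((powModel IG (r + 1)).prod IM) IG ∞ fun z : Pow G (r + 1) × M => z.1.1 :=
  ContMDiff.powHead contMDiff_fst

theorem contMDiff_secondFactor (r : ℕ) :
    ContMDiff ((powModel IG (r + 2)).prod IM) IG ∞ fun z : Pow G (r + 2) × M => z.1.2.1 :=
  ContMDiff.powHead (ContMDiff.powTail contMDiff_fst)

theorem isSmoothForm_thetaCoord (i : ι) :
    IsSmoothForm ((powModel IG 1).prod IM) (thetaCoord IM M b i) :=
  (isSmoothForm_maurerCartanCoord b i).pullForm (contMDiff_firstFactor 0)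

theorem dTheta_one : dTheta IG IM M b 1 = fun y =>
    lin (fun i => extD ((powModel IG 1).prod IM) (thetaCoord IM M b i) y)
      fun i => thetaCoord IM M b i y := by
  funext y
  rw [dTheta, totalDeRham, thetaForm, Pi.single_eq_same]
  exact deRham_sum_mulE (I := (powModel IG 1).prod IM) (thetaCoord IM M b) y

theorem dTheta_of_ne {r : ℕ} (hr : r ≠ 1) : dTheta IG IM M b r = 0 := by
  rw [dTheta, totalDeRham, thetaForm, Pi.single_eq_of_ne hr, deRham_zero]

variable (IG) in
/-- The pullback of the form to `G ^ 0 × M`. -/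
def iotaPull (IM : ModelWithCorners ℝ EM HM) (Ω : M → EM [⋀^Fin 2]→L[ℝ] ℝ) :
    Pow G 0 × M → (PowE EG 0 × EM) [⋀^Fin 2]→L[ℝ] ℝ :=
  pullForm IM ((powModel IG 0).prod IM) (fun z : Pow G 0 × M => z.2) Ω

variable {Ω : M → EM [⋀^Fin 2]→L[ℝ] ℝ}

theorem iotaForm_zero : (iotaForm IG IM Ω : Total EG G EM M ι) 0 =
    fun y => ofDegree (iotaPull IG IM Ω y) := by
  rw [iotaForm, Pi.single_eq_same]
  rfl

theorem iotaForm_of_ne {r : ℕ} (hr : r ≠ 0) : (iotaForm IG IM Ω : Total EG G EM M ι) r = 0 :=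
  Pi.single_eq_of_ne hr _

theorem isSmoothForm_iotaPull (hΩ : IsSymplectic IM Ω) :
    IsSmoothForm ((powModel IG 0).prod IM) (iotaPull (G := G) IG IM Ω) :=
  hΩ.smooth.pullForm contMDiff_snd

theorem extD_iotaPull (hΩ : IsSymplectic IM Ω) :
    extD ((powModel IG 0).prod IM) (iotaPull (G := G) IG IM Ω) = 0 := by
  rw [iotaPull, extD_pullForm contMDiff_snd hΩ.smooth, hΩ.closed]
  rfl

variable {μ : M → Module.Dual ℝ (GroupLieAlgebra IG G)}

variable (IM) in
/-- The contraction of `dθ` with the moment map. -/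
def momentTheta (μ : M → Module.Dual ℝ (GroupLieAlgebra IG G)) (y : Pow G 1 × M) :
    (PowE EG 1 × EM) [⋀^Fin 2]→L[ℝ] ℝ :=
  ∑ i, (μ y.2 (b i) • extD ((powModel IG 1).prod IM) (thetaCoord IM M b i) y +
    wedge (differential ((powModel IG 1).prod IM) (fun y : Pow G 1 × M => μ y.2 (b i)) y)
      (thetaCoord IM M b i y))

/-- The scalar `s` will be `1` or `-1`, so that `ω + dθ` and `ω - dθ` are treated together. -/
theorem internal_lin_extD_thetaCoord (s : ℝ) :
    internal ((powModel IG 1).prod IM) (fun i (y : Pow G 1 × M) => μ y.2 (b i)) (fun y =>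
      lin (fun i => extD ((powModel IG 1).prod IM) (s • thetaCoord IM M b i) y)
        fun i => (s • thetaCoord IM M b i) y) =
      fun y => ofDegree (s • momentTheta IM b μ y) := by
  funext y
  refine (internal_lin (I := (powModel IG 1).prod IM) (fun i y => μ y.2 (b i))
    (fun i => extD ((powModel IG 1).prod IM) (s • thetaCoord IM M b i))
    (fun i => s • thetaCoord IM M b i) y).trans ?_
  congr 1
  rw [momentTheta, Finset.smul_sum]
  refine Finset.sum_congr rfl fun i _ => ?_
  rw [extD_const_smul, Pi.smul_apply, Pi.smul_apply, wedge_smul, smul_add, smul_comm]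

theorem totalInternal_dTheta :
    totalInternal IG IM b μ (dTheta IG IM M b) 1 =
      fun y => ofDegree (momentTheta IM b μ y) := by
  have h := internal_lin_extD_thetaCoord (IM := IM) (M := M) (μ := μ) b 1
  simp only [one_smul] at h
  rw [totalInternal, dTheta_one b]
  exact h

/-- On `G × M` the two face maps followed by the projection to `M` are the projection and the
action. A pure form involves no generators, so the face matrix plays no role. -/
theorem facePull_iotaForm (hμ : IsHamiltonian IG IM Ω μ) :
    facePull IG IM b 0 0 (iotaForm IG IM Ω 0) - facePull IG IM b 0 1 (iotaForm IG IM Ω 0) =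
      fun y => ofDegree (momentTheta IM b μ y) := by
  rw [iotaForm_zero, facePull, facePull, gradedPull_ofDegree, gradedPull_ofDegree]
  funext y
  have hp := contMDiff_firstFactor (IG := IG) (IM := IM) (G := G) (M := M) 0
  have hq : ContMDiff ((powModel IG 1).prod IM) IM ∞ fun z : Pow G 1 × M => z.2 := contMDiff_snd
  have h0 : ContMDiff ((powModel IG 0).prod IM) IM ∞ fun z : Pow G 0 × M => z.2 := contMDiff_snd
  have htail : ContMDiff ((powModel IG 1).prod IM) (powModel IG 0) ∞
      fun z : Pow G 1 × M => z.1.2 := ContMDiff.powTail contMDiff_fst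
  have hs : ContMDiff ((powModel IG 1).prod IM) ((powModel IG 0).prod IM) ∞
      (face 0 0 : Pow G 1 × M → Pow G 0 × M) := htail.prodMk hq
  have ht : ContMDiff ((powModel IG 1).prod IM) ((powModel IG 0).prod IM) ∞
      (face 0 1 : Pow G 1 × M → Pow G 0 × M) := htail.prodMk (hp.smul hq)
  have h1 := pullForm_sub_pullForm_smul b hμ hp hq y
  have h2 : pullForm ((powModel IG 0).prod IM) ((powModel IG 1).prod IM) (face 0 0)
      (iotaPull IG IM Ω) = pullForm IM ((powModel IG 1).prod IM) (fun z : Pow G 1 × M => z.2) Ω :=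
    pullForm_comp h0 hs Ω
  have h3 : pullForm ((powModel IG 0).prod IM) ((powModel IG 1).prod IM) (face 0 1)
      (iotaPull IG IM Ω) =
        pullForm IM ((powModel IG 1).prod IM) (fun z : Pow G 1 × M => z.1.1 • z.2) Ω :=
    pullForm_comp h0 ht Ω
  rw [Pi.sub_apply, h2, h3]
  have h4 {k : ℕ} (η ζ : (PowE EG 1 × EM) [⋀^Fin k]→L[ℝ] ℝ) :
      (ofDegree η - ofDegree ζ : Fib ι (PowE EG 1 × EM)) = ofDegree (η - ζ) := by
    funext J K
    simp only [Pi.sub_apply, ofDegree_apply]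
    split_ifs
    · exact (Pi.single_sub (f := fun l => (PowE EG 1 × EM) [⋀^Fin l]→L[ℝ] ℝ) k η ζ).symm
    · exact sub_zero _
  rw [h4, h1]
  rfl

/-- The alternating sum of the pullbacks of `d (s • θ)` along the three face maps
`G ^ 2 × M → G × M` vanishes. -/
theorem sum_facePull_lin_extD_thetaCoord (s : ℝ) :
    ∑ k ∈ Finset.range 3, (-1 : ℝ) ^ k • facePull IG IM b 1 k (fun y =>
      lin (fun i => extD ((powModel IG 1).prod IM) (s • thetaCoord IM M b i) y)
        fun i => (s • thetaCoord IM M b i) y) = 0 := by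
  have hp := contMDiff_firstFactor (IG := IG) (IM := IM) (G := G) (M := M) 1
  have hq := contMDiff_secondFactor (IG := IG) (IM := IM) (G := G) (M := M) 0
  have hm : ContMDiff ((powModel IG 2).prod IM) IM ∞ fun z : Pow G 2 × M => z.2 := contMDiff_snd
  have htail : ContMDiff ((powModel IG 2).prod IM) (powModel IG 1) ∞
      fun z : Pow G 2 × M => z.1.2 := ContMDiff.powTail contMDiff_fst
  have htail' : ContMDiff ((powModel IG 2).prod IM) (powModel IG 0) ∞
      fun z : Pow G 2 × M => z.1.2.2 := ContMDiff.powTail htail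
  have hf0 : ContMDiff ((powModel IG 2).prod IM) ((powModel IG 1).prod IM) ∞
      (face 1 0 : Pow G 2 × M → Pow G 1 × M) := htail.prodMk hm
  have hf1 : ContMDiff ((powModel IG 2).prod IM) ((powModel IG 1).prod IM) ∞
      (face 1 1 : Pow G 2 × M → Pow G 1 × M) := (ContMDiff.powCons (hp.mul hq) htail').prodMk hm
  have hf2 : ContMDiff ((powModel IG 2).prod IM) ((powModel IG 1).prod IM) ∞
      (face 1 2 : Pow G 2 × M → Pow G 1 × M) :=
    (ContMDiff.powCons hp htail').prodMk (hq.smul hm)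
  have hζ (i : ι) := (isSmoothForm_thetaCoord (IM := IM) (M := M) b i).const_smul s
  set θ := maurerCartanCoord IG b with hθ
  have h1 := contMDiff_firstFactor (IG := IG) (IM := IM) (G := G) (M := M) 0
  have hpull (k : ℕ) (hk : ContMDiff ((powModel IG 2).prod IM) ((powModel IG 1).prod IM) ∞
      (face 1 k : Pow G 2 × M → Pow G 1 × M)) (i : ι) :
      pullForm ((powModel IG 1).prod IM) ((powModel IG 2).prod IM) (face 1 k)
        (s • thetaCoord IM M b i) = s • pullForm IG ((powModel IG 2).prod IM)
          (fun z : Pow G 2 × M => (face 1 k z).1.1) (θ i) := by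
    rw [← pullForm_comp h1 hk]
    rfl
  set B0 : ι → Pow G 2 × M → (PowE EG 2 × EM) [⋀^Fin 1]→L[ℝ] ℝ := fun a =>
    s • pullForm IG ((powModel IG 2).prod IM) (fun z : Pow G 2 × M => z.1.2.1) (θ a) with hB0
  set B1 : ι → Pow G 2 × M → (PowE EG 2 × EM) [⋀^Fin 1]→L[ℝ] ℝ := fun a =>
    s • pullForm IG ((powModel IG 2).prod IM) (fun z : Pow G 2 × M => z.1.1 * z.1.2.1) (θ a)
    with hB1
  set B2 : ι → Pow G 2 × M → (PowE EG 2 × EM) [⋀^Fin 1]→L[ℝ] ℝ := fun a =>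
    ∑ i, fun z => adMatrix b a i (z.1.2.1)⁻¹ •
      (s • pullForm IG ((powModel IG 2).prod IM) (fun z : Pow G 2 × M => z.1.1) (θ i)) z with hB2
  have hc (a i : ι) : ContMDiff ((powModel IG 2).prod IM) 𝓘(ℝ, ℝ) ∞
      fun z : Pow G 2 × M => adMatrix b a i (z.1.2.1)⁻¹ :=
    (contMDiff_adMatrix b a i).comp hq.inv
  -- Multiplicativity of `θ`: `B0`, `B1`, `B2` are the components of the three face pullbacks of `s
  -- • θ`, and `B2` contains the `Ad`-twist of the last face.
  have hB12 (a : ι) : B1 a = B2 a + B0 a := by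
    simp only [hB0, hB1, hB2]
    rw [hθ, pullForm_mul_maurerCartanCoord b hp hq, smul_add, Finset.smul_sum]
    congr 1
    refine Finset.sum_congr rfl fun i _ => ?_
    funext z
    ext v
    simp only [Pi.smul_apply, ContinuousAlternatingMap.smul_apply, smul_eq_mul]
    ring
  have hconst (k : ℕ) (hk : k ≠ 2) (a i : ι) :
      faceMatrix (M := M) IG b 1 k a i = fun _ => if a = i then 1 else 0 := by
    funext z
    simp [faceMatrix, hk]
  have hdiag (k : ℕ) (hk : k ≠ 2) (hf : ContMDiff ((powModel IG 2).prod IM)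
      ((powModel IG 1).prod IM) ∞ (face 1 k : Pow G 2 × M → Pow G 1 × M)) :
      facePull IG IM b 1 k (fun y =>
        lin (fun i => extD ((powModel IG 1).prod IM) (s • thetaCoord IM M b i) y)
          fun i => (s • thetaCoord IM M b i) y) = fun x =>
        lin (fun a => extD ((powModel IG 2).prod IM) (s • pullForm IG ((powModel IG 2).prod IM)
          (fun z : Pow G 2 × M => (face 1 k z).1.1) (θ a)) x)
          fun a => (s • pullForm IG ((powModel IG 2).prod IM)
            (fun z : Pow G 2 × M => (face 1 k z).1.1) (θ a)) x := by
    refine gradedPull_lin_extD hf (fun a i => ?_) hζ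
      (B := fun a => s • pullForm IG ((powModel IG 2).prod IM)
            (fun z : Pow G 2 × M => (face 1 k z).1.1) (θ a)) fun a => ?_
    · rw [hconst k hk]
      exact contMDiff_const
    · funext x
      simp [hconst k hk, hpull k hf]
  have e0 := hdiag 0 (by norm_num) hf0
  have e1 := hdiag 1 (by norm_num) hf1
  have e2 : facePull IG IM b 1 2 (fun y =>
        lin (fun i => extD ((powModel IG 1).prod IM) (s • thetaCoord IM M b i) y)
          fun i => (s • thetaCoord IM M b i) y) = fun x =>
        lin (fun a => extD ((powModel IG 2).prod IM) (B2 a) x) fun a => B2 a x := by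
    refine gradedPull_lin_extD hf2 (fun a i => hc a i) hζ (B := B2) fun a => ?_
    simp only [hpull 2 hf2]
    rfl
  have hsmooth0 (a : ι) : IsSmoothForm ((powModel IG 2).prod IM) (B0 a) :=
    ((isSmoothForm_maurerCartanCoord b a).pullForm hq).const_smul s
  have hsmooth2 (a : ι) : IsSmoothForm ((powModel IG 2).prod IM) (B2 a) :=
    IsSmoothForm.sum _ fun i _ =>
      (((isSmoothForm_maurerCartanCoord b i).pullForm hp).const_smul s).smul (hc a i)
  have e1' : facePull IG IM b 1 1 (fun y =>
        lin (fun i => extD ((powModel IG 1).prod IM) (s • thetaCoord IM M b i) y)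
          fun i => (s • thetaCoord IM M b i) y) = fun x =>
        lin (fun a => extD ((powModel IG 2).prod IM) (B2 a) x +
          extD ((powModel IG 2).prod IM) (B0 a) x) fun a => B2 a x + B0 a x := by
    rw [e1]
    funext x
    change lin (fun a => extD ((powModel IG 2).prod IM) (B1 a) x) (fun a => B1 a x) = _
    simp only [hB12, extD_add (hsmooth2 _) (hsmooth0 _), Pi.add_apply]
  rw [Finset.sum_range_succ, Finset.sum_range_succ, Finset.sum_range_one, e0, e1', e2]
  funext x
  simp only [pow_zero, pow_one, Pi.add_apply, Pi.smul_apply, lin_smul, lin_add]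
  -- The cancellation `B0 - (B2 + B0) + B2 = 0`, in any degree `l`: it is used for the 1-forms and
  -- for their exterior derivatives.
  have hz {l : ℕ} (A B : ι → (PowE EG 2 × EM) [⋀^Fin l]→L[ℝ] ℝ) :
      ((1 : ℝ) • A + (-1 : ℝ) • (fun a => B a + A a)) + (-1 : ℝ) ^ 2 • B = 0 := by
    funext a
    ext v
    simp
  exact (congrArg₂ lin (hz _ _) (hz _ _)).trans lin_zero

theorem totalSimplicial_dTheta : totalSimplicial IG IM b (dTheta IG IM M b) = 0 := by
  funext r
  match r with
  | 0 => rfl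
  | 2 =>
    rw [totalSimplicial, dTheta_one]
    have h := sum_facePull_lin_extD_thetaCoord (IM := IM) (M := M) b 1
    simp only [one_smul] at h
    exact h
  | 1 =>
    rw [totalSimplicial, dTheta_of_ne b (by norm_num)]
    refine Finset.sum_eq_zero fun k _ => ?_
    rw [facePull, gradedPull_zero, smul_zero]
  | r + 3 =>
    rw [totalSimplicial, dTheta_of_ne b (by omega)]
    refine Finset.sum_eq_zero fun k _ => ?_
    rw [facePull, gradedPull_zero, smul_zero]

/-- The form `ω` has `(p, r, q) = (2, 0, 0)`, while `E_i dθ_i` and `dE_i θ_i` both have `(2, 1,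
-1)`. -/
theorem reducedForm_mem_DR (hΩ : IsSymplectic IM Ω) : reducedForm IG IM b Ω ∈ DR IG IM 2 := by
  have h0 : reducedForm IG IM b Ω 0 = fun y => ofDegree (iotaPull IG IM Ω y) := by
    rw [reducedForm, Pi.add_apply, dTheta_of_ne b (by norm_num), add_zero, iotaForm_zero]
  have h1 : reducedForm IG IM b Ω 1 = fun y =>
      lin (fun i => extD ((powModel IG 1).prod IM) (thetaCoord IM M b i) y)
        fun i => thetaCoord IM M b i y := by
    rw [reducedForm, Pi.add_apply, iotaForm_of_ne (by norm_num), zero_add, dTheta_one]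
  have h2 (r : ℕ) : reducedForm IG IM b Ω (r + 2) = 0 := by
    rw [reducedForm, Pi.add_apply, iotaForm_of_ne (by omega), dTheta_of_ne b (by omega), add_zero]
  constructor
  · intro r J K l
    match r with
    | 0 =>
      rw [h0]
      exact isSmoothForm_ofDegree (isSmoothForm_iotaPull hΩ) J K l
    | 1 =>
      rw [h1]
      exact isSmoothForm_lin (fun i => (isSmoothForm_thetaCoord b i).extD)
        (fun i => isSmoothForm_thetaCoord b i) J K l
    | r + 2 =>
      rw [h2]
      exact isSmoothForm_zero
  · intro r J K l hd y
    match r with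
    | 0 =>
      rw [h0]
      beta_reduce
      rw [ofDegree_apply]
      split_ifs with h
      · obtain ⟨rfl, rfl⟩ := h
        refine homog_of_ne _ fun hl => hd ?_
        subst hl
        simp [formDegree, derivedDegree]
      · rfl
    | 1 =>
      rw [h1]
      rcases linear_cases J K with ⟨j, rfl, rfl⟩ | ⟨j, rfl, rfl⟩ | ⟨h, h'⟩
      · simp only [lin_singleton]
        refine homog_of_ne _ fun hl => hd ?_
        subst hl
        simp [formDegree, derivedDegree]
      · simp only [lin_empty_single]
        refine homog_of_ne _ fun hl => hd ?_
        subst hl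
        simp [formDegree, derivedDegree, ← Nat.cast_sum]
      · beta_reduce
        rw [lin_eq_zero h h']
        rfl
    | r + 2 =>
      rw [h2]
      rfl

/-- The sum of the pullback of `Ω` and of `s • dθ`, with a sign `s`, is closed for the total
differential with the opposite sign. -/
theorem totalD_eq_zero (hΩ : IsSymplectic IM Ω) (hμ : IsHamiltonian IG IM Ω μ) (s : ℝ) (ε : ℤˣ)
    (hε : ((ε : ℤ) : ℝ) = -s) :
    totalD IG IM b μ ε (iotaForm IG IM Ω + s • dTheta IG IM M b) = 0 := by
  set F : Total EG G EM M ι := iotaForm IG IM Ω + s • dTheta IG IM M b with hF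
  have h0 : F 0 = fun y => ofDegree (iotaPull IG IM Ω y) := by
    rw [hF, Pi.add_apply, Pi.smul_apply, dTheta_of_ne b (by norm_num), smul_zero, add_zero,
      iotaForm_zero]
  have h1 : F 1 = fun y =>
      lin (fun i => extD ((powModel IG 1).prod IM) (s • thetaCoord IM M b i) y)
        fun i => (s • thetaCoord IM M b i) y := by
    rw [hF, Pi.add_apply, Pi.smul_apply, iotaForm_of_ne (by norm_num), zero_add, dTheta_one]
    funext y
    rw [Pi.smul_apply, lin_smul]
    simp only [extD_const_smul]
    rfl
  have h2 (r : ℕ) : F (r + 2) = 0 := by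
    rw [hF, Pi.add_apply, Pi.smul_apply, iotaForm_of_ne (by omega), dTheta_of_ne b (by omega),
      smul_zero, add_zero]
  have hzero {r : ℕ} (hr : F r = 0) : totalSimplicial IG IM b F (r + 1) = 0 := by
    rw [totalSimplicial, hr]
    refine Finset.sum_eq_zero fun k _ => ?_
    rw [facePull, gradedPull_zero, smul_zero]
  have hvanish {r : ℕ} (hd : totalDeRham IG IM F r = 0) (hi : totalInternal IG IM b μ F r = 0)
      (hs : totalSimplicial IG IM b F r = 0) : totalD IG IM b μ ε F r = 0 := by
    funext y J K l
    simp only [totalD, hd, hi, hs, Pi.zero_apply, smul_zero, add_zero]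
  funext r
  match r with
  | 0 =>
    refine hvanish ?_ ?_ rfl
    · funext y
      rw [totalDeRham, h0, deRham_ofDegree, extD_iotaPull hΩ]
      funext J K
      rw [Pi.zero_apply, ofDegree_apply, homog_zero, ite_self]
      rfl
    · rw [totalInternal, h0, internal_ofDegree]
  | 1 =>
    have hd : totalDeRham IG IM F 1 = 0 := by
      funext y
      rw [totalDeRham, h1]
      exact deRham_lin_extD (fun i => extD_extD
        ((isSmoothForm_thetaCoord (IM := IM) (M := M) b i).const_smul s)) y
    have hi : totalInternal IG IM b μ F 1 = fun y => ofDegree (s • momentTheta IM b μ y) := by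
      rw [totalInternal, h1]
      exact internal_lin_extD_thetaCoord b s
    have hs : totalSimplicial IG IM b F 1 = fun y => ofDegree (momentTheta IM b μ y) := by
      have hneg (X : Pow G 1 × M → Fib ι (PowE EG 1 × EM)) : (-1 : ℝ) • X = -X := by
        funext y J K l
        ext v
        simp
      rw [← facePull_iotaForm b hμ, totalSimplicial, h0, iotaForm_zero, Finset.sum_range_succ,
        Finset.sum_range_one, pow_zero, pow_one, one_smul, hneg, ← sub_eq_add_neg]
    funext y J K l
    simp only [totalD, hd, hi, hs, Pi.zero_apply, zero_add, ofDegree_apply]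
    split_ifs with h
    · obtain ⟨rfl, rfl⟩ := h
      by_cases hl : l = 2
      -- Here `p = 2` and `q = 0`, so both degree signs are `+1` and the component is `(s + ε)`
      -- times `ι_μ dθ`, which vanishes.
      · subst hl
        have hp : formDegree (∅ : Finset ι) 0 2 = 2 := by simp [formDegree]
        have hq : derivedDegree (∅ : Finset ι) 0 2 = 0 := by simp [derivedDegree]
        have hsign : (2 : ℤ).negOnePow = 1 := Int.negOnePow_even 2 (by decide)
        rw [hp, hq, add_zero, hsign, mul_one, homog_self, homog_self]
        ext v
        have hv : ((ε : ℤ) : ℝ) * momentTheta IM b μ y v = -s * momentTheta IM b μ y v := by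
          rw [hε]
        simp only [ContinuousAlternatingMap.add_apply, ContinuousAlternatingMap.smul_apply,
          zsmul_eq_mul, smul_eq_mul, Units.val_one, Int.cast_one, one_mul]
        rw [hv]
        simp
      · rw [homog_of_ne _ hl, homog_of_ne _ hl, smul_zero, smul_zero, add_zero]
    · simp
  | 2 =>
    refine hvanish ?_ ?_ ?_
    · rw [totalDeRham, h2 0, deRham_zero]
    · rw [totalInternal, h2 0, internal_zero]
    · rw [totalSimplicial, h1]
      exact sum_facePull_lin_extD_thetaCoord (IM := IM) (M := M) b s
  | r + 3 =>
    refine hvanish ?_ ?_ (hzero (h2 r))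
    · rw [totalDeRham, h2 (r + 1), deRham_zero]
    · rw [totalInternal, h2 (r + 1), internal_zero]

end Complex

end BottShulman

end

/-! ### The theorem -/

open BottShulman in
theorem proposition7
    {EG : Type*} [NormedAddCommGroup EG] [NormedSpace ℝ EG] [FiniteDimensional ℝ EG]
    {HG : Type*} [TopologicalSpace HG] (IG : ModelWithCorners ℝ EG HG) [IG.Boundaryless]
    {G : Type*} [TopologicalSpace G] [ChartedSpace HG G] [Group G] [LieGroup IG ∞ G]
    {EM : Type*} [NormedAddCommGroup EM] [NormedSpace ℝ EM] [FiniteDimensional ℝ EM]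
    {HM : Type*} [TopologicalSpace HM] (IM : ModelWithCorners ℝ EM HM) [IM.Boundaryless]
    {M : Type*} [TopologicalSpace M] [ChartedSpace HM M] [IsManifold IM ∞ M]
    [MulAction G M] [ContMDiffSMul IG IM ∞ G M]
    {ι : Type*} [Fintype ι] [LinearOrder ι] (b : Module.Basis ι ℝ (GroupLieAlgebra IG G))
    (Ω : M → EM [⋀^Fin 2]→L[ℝ] ℝ) (hΩ : IsSymplectic IM Ω)
    (μ : M → Module.Dual ℝ (GroupLieAlgebra IG G)) (hμ : IsHamiltonian IG IM Ω μ) :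
    facePull IG IM b 0 0 (iotaForm IG IM Ω 0) - facePull IG IM b 0 1 (iotaForm IG IM Ω 0) =
      totalInternal IG IM b μ (dTheta IG IM M b) 1 ∧
    totalSimplicial IG IM b (dTheta IG IM M b) = 0 ∧
    reducedForm IG IM b Ω ∈ DR IG IM 2 ∧
    totalD IG IM b μ (-1) (reducedForm IG IM b Ω) = 0 ∧
    totalD IG IM b μ 1 (iotaForm IG IM Ω - dTheta IG IM M b) = 0 := by
  refine ⟨?_, totalSimplicial_dTheta b, reducedForm_mem_DR b hΩ, ?_, ?_⟩
  · rw [facePull_iotaForm b hμ, totalInternal_dTheta]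
  · have h := totalD_eq_zero b hΩ hμ 1 (-1) (by simp)
    rwa [one_smul] at h
  -- The statement for `D_+` is the same lemma with both signs reversed, so the conjugation by
  -- `(-1)^r` is not needed.
  · have h := totalD_eq_zero b hΩ hμ (-1) 1 (by simp)
    have hneg : iotaForm IG IM Ω + (-1 : ℝ) • dTheta IG IM M b =
        iotaForm IG IM Ω - dTheta IG IM M b := by
      funext r y J K l
      ext v
      simp [sub_eq_add_neg]
    rwa [hneg] at h
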